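/- Let $a<t<b$, $\alpha<\beta$, let $m\ge 1$ and $q\ge 1$ be integers, and let $f(x)=g(x)/(x-t)^m$, where $g:(a,b)\to\mathbb{R}$ is in $C^\infty(a,b)$ and integrable on $(a,b)$. Let $\psi\in C[\alpha,\beta]\cap C^\infty(\alpha,\beta)$ with $\psi(\alpha)=a$, $\psi(\beta)=b$ and $\psi'(\xi)>0$ for $\xi\in(\alpha,\beta)$, and let $\tau\in(\alpha,\beta)$ be the point with $\psi(\tau)=t$. Put $\mathcal{T}=\beta-\alpha$, $F(\xi)=f(\psi(\xi))\psi'(\xi)$ for $\xi\in(\alpha,\beta)$, $F(\alpha)=F(\beta)=0$, let $\mathcal{F}$ be the $\mathcal{T}$-periodic extension of $F$ to $\mathbb{R}$, and let $$G(\xi)=\frac{g(\psi(\xi))}{(\psi[\xi,\tau])^m}\,\psi'(\xi),\qquad \psi[\xi,\tau]=\frac{\psi(\xi)-\psi(\tau)}{\xi-\tau}\ (\xi\ne\tau),\quad \psi[\tau,\tau]=\psi'(\tau),$$ so that $F(\xi)=G(\xi)/(\xi-\tau)^m$ for $\xi\in(\alpha,\beta)\setminus\{\tau\}$. Say that condition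 $(P_q)$ holds for $(g,m,\tau)$ (with $\psi$ fixed and $t=\psi(\tau)$) if * $\lim_{\xi\to\alpha+}\mathcal{F}^{(i)}(\xi)=0=\lim_{\xi\to\beta-}\mathcal{F}^{(i)}(\xi)$ for $i=0,1,\dots,q-1$, and * $\mathcal{F}^{(q)}$ is absolutely integrable on every closed interval that contains none of the points $\tau+k\mathcal{T}$, $k\in\mathbb{Z}$. For $n\ge 1$ and $h=\mathcal{T}/n$ define, writing $m=2r$ or $m=2r+1$, $$\widehat T^{(0)}_{2r,n}[\mathcal F]=h\sum_{j=1}^{n-1}\mathcal F(\tau+jh)-2\sum_{i=0}^{r}\frac{G^{(2i)}(\tau)}{(2i)!}\,\zeta(2r-2i)\,h^{-2r+2i+1},$$ $$\widehat T^{(0)}_{2r+1,n}[\mathcal F]=h\sum_{j=1}^{n-1}\mathcal F(\tau+jh)-2\sum_{i=0}^{r}\frac{G^{(2i+1)}(\tau)}{(2i+1)!}\,\zeta(2r-2i)\,h^{-2r+2i+1},$$ where $\zeta$ is the Riemann zeta function, and, for $s=0,1,\dots,\lfloor (m+2)/2\rfloor-1$, the Richardson-like extrapolations, which eliminate the powers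 $h^1,h^{-1},h^{-3},\dots$ in this order, $$\widehat T^{(s+1)}_{m,n}[\mathcal F]=\frac{2^{1-2s}\,\widehat T^{(s)}_{m,2n}[\mathcal F]-\widehat T^{(s)}_{m,n}[\mathcal F]}{2^{1-2s}-1}.$$ For a function $u$ whose only nonintegrable singularity in an interval $[c,d]$ is an interior point $p$, the Hadamard finite part of $\int_c^d u$ is obtained by expanding $\int_c^{p-\epsilon}u+\int_{p+\epsilon}^d u$ as $\epsilon\to0+$, discarding the terms (multiples of $\epsilon^{-1},\epsilon^{-2},\dots$ and $\log\epsilon$) that go to infinity, and taking the limit of what remains. Assume that $(P_q)$ holds for $(g,m,\tau)$. Then: 1. The Hadamard finite parts $I[f]$ of $\int_a^b f(x)\,dx$ and $I[F]$ of $\int_\alpha^\beta F(\xi)\,d\xi$ exist and are equal, and for every $s\in\{0,1,\dots,\lfloor (m+2)/2\rfloor\}$, $$\lim_{n\to\infty}\widehat T^{(s)}_{m,n}[\mathcal F]=I[f]=I[F],\qquad \widehat T^{(s)}_{m,n}[\mathcal F]-I[f]=O(n^{-q})\quad\text{as } n\to\infty .$$ 2. As far as $g$ is concerned, $q$ depends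 only on the behaviour of $g$ at the endpoints: if $g_1\in C^\infty(a,b)$ coincides with $g$ near $a$ and near $b$, then $(P_q)$ holds for $(g_1,m,\tau)$. 3. $q$ is independent of $m$ (and of the position of the singularity): if $\psi\in C^q[\alpha,\beta]$, then $(P_q)$ holds for $(g,m_1,\tau_1)$ for every integer $m_1\ge1$ and every $\tau_1\in(\alpha,\beta)$. -/

import Mathlib

open Set Filter MeasureTheory Asymptotics
open scoped Topology ContDiff

namespace PVTSI

/-- Let `u` be a real function whose only nonintegrable singularity in `[a, b]` is the point `t`, with
`a < t < b`. `HasHadamardFinitePart u a b t I` says that `I` is the Hadamard finite part of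
`∫_a^b u`: expand `φ(ε) = ∫_a^{t-ε} u + ∫_{t+ε}^b u` as `ε → 0+`, discard the terms that go to
infinity (negative integer powers of `ε`, and `log ε`), and keep the limit of what remains. -/
structure HasHadamardFinitePart (u : ℝ → ℝ) (a b t I : ℝ) : Prop where
  integrable_left : ∀ ε : ℝ, 0 < ε → ε < t - a → IntervalIntegrable u volume a (t - ε)
  integrable_right : ∀ ε : ℝ, 0 < ε → ε < b - t → IntervalIntegrable u volume (t + ε) b
  expansion : ∃ (N : ℕ) (c : ℕ → ℝ) (d : ℝ),
    Tendsto (fun ε : ℝ => (∫ x in a..(t - ε), u x) + (∫ x in (t + ε)..b, u x)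
      - (∑ k ∈ Finset.range N, c k * (ε ^ (k + 1))⁻¹ + d * Real.log ε)) (𝓝[>] 0) (𝓝 I)

/-- The Hadamard finite part is unique. -/
theorem HasHadamardFinitePart.unique {u : ℝ → ℝ} {a b t I J : ℝ}
    (hI : HasHadamardFinitePart u a b t I) (hJ : HasHadamardFinitePart u a b t J) : I = J := by
  obtain ⟨N, c, d, h1⟩ := hI.expansion
  obtain ⟨N', c', d', h2⟩ := hJ.expansion
  have h3 := (h1.sub h2).comp tendsto_inv_atTop_nhdsGT_zero
  let Q : Polynomial ℝ := (∑ k ∈ Finset.range N', Polynomial.C (c' k) * Polynomial.X ^ k)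
    - ∑ k ∈ Finset.range N, Polynomial.C (c k) * Polynomial.X ^ k
  have h4 : Tendsto (fun x : ℝ => x * Q.eval x + (d - d') * Real.log x) atTop (𝓝 (I - J)) := by
    refine h3.congr fun x => ?_
    simp only [Function.comp, Real.log_inv, inv_pow, Q, Polynomial.eval_sub,
      Polynomial.eval_finsetSum, Polynomial.eval_mul, Polynomial.eval_C, Polynomial.eval_pow,
      Polynomial.eval_X, mul_sub, Finset.mul_sum, pow_succ]
    have e1 : ∀ (M : ℕ) (w : ℕ → ℝ), ∑ k ∈ Finset.range M, w k * ((x ^ k)⁻¹ * x⁻¹)⁻¹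
        = ∑ k ∈ Finset.range M, x * (w k * x ^ k) :=
      fun M w => Finset.sum_congr rfl fun k _ => by
        rw [mul_inv, inv_inv, inv_inv]
        ring
    rw [e1, e1]
    ring
  have hlog : Tendsto (fun x : ℝ => Real.log x / x) atTop (𝓝 0) :=
    Real.isLittleO_log_id_atTop.tendsto_div_nhds_zero
  have h5 : Tendsto (fun x : ℝ => Q.eval x) atTop (𝓝 0) := by
    have h6 := (h4.mul tendsto_inv_atTop_zero).sub (hlog.const_mul (d - d'))
    simp only [mul_zero, sub_zero] at h6
    refine h6.congr' ?_
    filter_upwards [eventually_gt_atTop 0] with x hx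
    field_simp
    ring
  have hQ : Q = 0 := by
    have := (Polynomial.tendsto_nhds_iff Q).1 h5
    exact Polynomial.leadingCoeff_eq_zero.1 this.1
  simp only [hQ, Polynomial.eval_zero, mul_zero, zero_add] at h4
  by_cases hd : d - d' = 0
  · simp only [hd, zero_mul] at h4
    have := tendsto_nhds_unique h4 tendsto_const_nhds
    linarith
  · exfalso
    have h7 := h4.const_mul (d - d')⁻¹
    refine not_tendsto_nhds_of_tendsto_atTop Real.tendsto_log_atTop _ (h7.congr fun x => ?_)
    field_simp

/-- The singular integrand `f(x) = g(x) / (x - t)^m`. -/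
noncomputable def integrand (g : ℝ → ℝ) (t : ℝ) (m : ℕ) (x : ℝ) : ℝ :=
  g x / (x - t) ^ m

/-- A variable transformation `x = ψ(ξ)`, `ψ : [α, β] → [a, b]`. -/
structure IsVariableTransformation (ψ : ℝ → ℝ) (α β a b : ℝ) : Prop where
  continuousOn : ContinuousOn ψ (Icc α β)
  contDiffOn : ContDiffOn ℝ ∞ ψ (Ioo α β)
  map_left : ψ α = a
  map_right : ψ β = b
  deriv_pos : ∀ ξ ∈ Ioo α β, 0 < deriv ψ ξ

/-- The transformed integrand `F(ξ) = f(ψ(ξ)) ψ'(ξ)` on `(α, β)`. The functions `f` and `ψ'` need not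
be defined at the endpoints; there `F` has the value `0`, which is the value by continuity for the
transformations considered (those with `F(α+) = F(β-) = 0`). -/
noncomputable def transformed (f ψ : ℝ → ℝ) (α β : ℝ) : ℝ → ℝ :=
  (Ioo α β).indicator fun ξ => f (ψ ξ) * deriv ψ ξ

/-- The `(β - α)`-periodic function on `ℝ` that agrees with `F` on `[α, β)`. -/
noncomputable def periodicExtension (F : ℝ → ℝ) (α β ξ : ℝ) : ℝ :=
  F (α + (β - α) * Int.fract ((ξ - α) / (β - α)))

/-- The periodic extension `𝓕` of `F(ξ) = f(ψ(ξ)) ψ'(ξ)`, where `f(x) = g(x) / (x - t)^m`. -/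
noncomputable def periodized (g : ℝ → ℝ) (t : ℝ) (m : ℕ) (ψ : ℝ → ℝ) (α β : ℝ) : ℝ → ℝ :=
  periodicExtension (transformed (integrand g t m) ψ α β) α β

/-- The regular factor `G(ξ) = g(ψ(ξ)) ψ'(ξ) / (ψ[ξ, τ])^m` in `F(ξ) = G(ξ) / (ξ - τ)^m`. Here
`ψ[ξ, τ]` is the divided difference, and `ψ[τ, τ] = ψ'(τ)`. -/
noncomputable def regularFactor (g ψ : ℝ → ℝ) (τ : ℝ) (m : ℕ) (ξ : ℝ) : ℝ :=
  g (ψ ξ) / (dslope ψ τ ξ) ^ m * deriv ψ ξ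

/-- `ℝ` without the points `τ + k T`, `k ∈ ℤ`. -/
def realsWithoutTranslates (τ T : ℝ) : Set ℝ :=
  {ξ | ∀ k : ℤ, ξ ≠ τ + k * T}

/-- The function `Φ` (a `(β - α)`-periodic extension, smooth on `(α, β)` away from `τ`) satisfies
`Φ^{(i)}(α) = Φ^{(i)}(β) = 0` for `i < q`, where the derivatives at the endpoints of `(α, β)` are
the limits from inside that interval, and `Φ^{(q)}` is absolutely integrable on every closed
interval that contains none of the points `τ + k (β - α)`. -/
structure IsPeriodizedToOrder (Φ : ℝ → ℝ) (α β τ : ℝ) (q : ℕ) : Prop where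
  left : ∀ i < q, Tendsto (iteratedDeriv i Φ) (𝓝[>] α) (𝓝 0)
  right : ∀ i < q, Tendsto (iteratedDeriv i Φ) (𝓝[<] β) (𝓝 0)
  integrable : ∀ c d : ℝ, Icc c d ⊆ realsWithoutTranslates τ (β - α) →
    IntegrableOn (iteratedDeriv q Φ) (Icc c d)

/-- The corrected trapezoidal rule `T̂^{(0)}_{m,n}` with period `T` and `h = T / n`:
for `m = 2r`, `h ∑_{j=1}^{n-1} Φ(τ+jh) - 2 ∑_{i=0}^r G^{(2i)}(τ)/(2i)! ζ(2r-2i) h^{-2r+2i+1}`;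
for `m = 2r+1`,
`h ∑_{j=1}^{n-1} Φ(τ+jh) - 2 ∑_{i=0}^r G^{(2i+1)}(τ)/(2i+1)! ζ(2r-2i) h^{-2r+2i+1}`. -/
noncomputable def correctedTrapezoidal (Φ G : ℝ → ℝ) (τ T : ℝ) (m n : ℕ) : ℝ :=
  let h : ℝ := T / n
  let r : ℕ := m / 2
  let e : ℕ := m % 2
  h * ∑ j ∈ Finset.Icc 1 (n - 1), Φ (τ + j * h)
    - 2 * ∑ i ∈ Finset.range (r + 1),
        iteratedDeriv (2 * i + e) G τ / (Nat.factorial (2 * i + e) : ℝ)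
          * (riemannZeta (2 * (r : ℂ) - 2 * (i : ℂ))).re * h ^ (-2 * (r : ℤ) + 2 * (i : ℤ) + 1)

/-- The quadrature formulas `T̂^{(s)}_{m,n}`: step `s + 1` of the Richardson-like extrapolation
combines the values for `n` and `2n` so as to eliminate the power `h^p`, `p = 1 - 2s`; thus the
successive steps eliminate `h^1, h^{-1}, h^{-3}, …`, in this order. -/
noncomputable def quadrature (Φ G : ℝ → ℝ) (τ T : ℝ) (m : ℕ) : ℕ → ℕ → ℝ
  | 0, n => correctedTrapezoidal Φ G τ T m n
  | s + 1, n =>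
      ((2 : ℝ) ^ (1 - 2 * (s : ℤ)) * quadrature Φ G τ T m s (2 * n) - quadrature Φ G τ T m s n)
        / ((2 : ℝ) ^ (1 - 2 * (s : ℤ)) - 1)

end PVTSI

namespace PVTSI

/-! Put `T = β - α` and let `c k` be the Taylor coefficients of the regular factor `G` at `τ`. The
proof subtracts from `F` a `T`-periodic function `W` (`poleSum`) with the same principal part `∑ c k
/ (ξ - τ)^(m-k)`, `k < m`. It is built from the functions `∑_l 1/(x+l)^p`, with `π cot (π x)` for `p
= 1`. Then `F = U + W` off `τ`, with `U` smooth on `(α, β)` (`exists_regularPart`). The derivatives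
of `F` of order below `q` vanish at both ends and `W` is periodic, so those of `U` have equal limits
at `α` and `β`. By Euler-Maclaurin the trapezoidal rule for the periodic continuation of `U`,
started at `τ`, approximates `∫ U` with error `O(h^q)` (`exists_trapezoidal_error_le`).

Two exact computations bring this back to `F`. First, the node sums of `W` are known: `∑_{j<n}
periodicPole p (j/n) = n^p * periodicPole p 0`, where the value at the pole is `2 ζ(p)` for even `p`
and `0` for odd `p`. These sums are the zeta corrections of the rule, and the remaining correction,
with `ζ(0) = -1/2`, supplies the missing node `τ`. So the corrected rule is exactly the trapezoidal
rule for `U` (`correctedTrapezoidal_eq`). Second, `W` has a periodic primitive whose jump across `τ`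
has no constant term, so the finite part of `∫ F` is `∫ U`.

Equality with the finite part of `∫ f` is a statement about jumps as well. If `B` is a primitive of
`f`, the jump `B(ψ(τ-ε)) - B(ψ(τ+ε))` expands into negative powers of `ε` plus a remainder tending
to `0`, for `ψ` and for the identity alike (`exists_primitive`).

The extrapolated rules are combinations, with weights of sum one, of rules that already have error
`O(n^{-q})`, so they inherit limit and order. For the last two assertions, the condition on `F` is
local at the endpoints (`isPeriodizedToOrder_iff`). Moving the pole or changing its order multiplies
`F` there by a function that is `C^q` up to the endpoint, and the Leibniz rule applies. -/

/-! ### Smooth divided differences and Taylor's formula -/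

theorem hasDerivAt_integral_comp_segment {f w : ℝ → ℝ} {a b τ x₀ : ℝ}
    (hf : ContDiffOn ℝ 1 f (Ioo a b)) (hw : Continuous w) (hτ : τ ∈ Ioo a b) (hx₀ : x₀ ∈ Ioo a b) :
    HasDerivAt (fun x => ∫ s in (0 : ℝ)..1, w s * f (τ + s * (x - τ)))
      (∫ s in (0 : ℝ)..1, (w s * s) * deriv f (τ + s * (x₀ - τ))) x₀ := by
  -- The compact interval `[c, d]` has `τ` and `x₀` in its interior. It contains every segment from
  -- `τ` to a point near `x₀`, and the bound of `deriv f` on it dominates the differentiated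
  -- integrand.
  obtain ⟨c, hac, hc⟩ := exists_between (lt_min hτ.1 hx₀.1)
  obtain ⟨d, hd, hdb⟩ := exists_between (max_lt hτ.2 hx₀.2)
  rw [lt_min_iff] at hc
  rw [max_lt_iff] at hd
  have hcd : Icc c d ⊆ Ioo a b := fun y hy => ⟨hac.trans_le hy.1, hy.2.trans_lt hdb⟩
  have hmem : ∀ x ∈ Ioo c d, ∀ s ∈ Icc (0 : ℝ) 1, τ + s * (x - τ) ∈ Icc c d := by
    intro x hx s hs
    have := (convex_Icc c d).add_smul_sub_mem (x := τ) (y := x) ⟨hc.1.le, hd.1.le⟩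
      ⟨hx.1.le, hx.2.le⟩ hs
    simpa using this
  have hdc : ContinuousOn (deriv f) (Ioo a b) := hf.continuousOn_deriv_of_isOpen isOpen_Ioo le_rfl
  have hder : ∀ y ∈ Ioo a b, HasDerivAt f (deriv f y) y := fun y hy =>
    ((hf.differentiableOn one_ne_zero).differentiableAt (isOpen_Ioo.mem_nhds hy)).hasDerivAt
  obtain ⟨M, hM⟩ := isCompact_Icc.exists_bound_of_continuousOn (hdc.mono hcd)
  obtain ⟨K, hK⟩ := (isCompact_Icc (a := (0 : ℝ)) (b := 1)).exists_bound_of_continuousOn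
    hw.continuousOn
  have hline : ∀ x : ℝ, Continuous fun s : ℝ => τ + s * (x - τ) := fun x => by fun_prop
  have hcont : ∀ x ∈ Ioo c d, ContinuousOn (fun s => w s * f (τ + s * (x - τ))) (Icc 0 1) :=
    fun x hx => hw.continuousOn.mul ((hf.continuousOn.mono hcd).comp (hline x).continuousOn
      (hmem x hx))
  have hcont' : ContinuousOn (fun s => (w s * s) * deriv f (τ + s * (x₀ - τ))) (Icc 0 1) :=
    (hw.mul continuous_id).continuousOn.mul ((hdc.mono hcd).comp (hline x₀).continuousOn
      (hmem x₀ ⟨hc.2, hd.2⟩))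
  have hsub : uIoc (0 : ℝ) 1 ⊆ Icc (0 : ℝ) 1 := by
    rw [uIoc_of_le zero_le_one]; exact Ioc_subset_Icc_self
  refine (intervalIntegral.hasDerivAt_integral_of_dominated_loc_of_deriv_le
    (bound := fun _ => K * M) (s := Ioo c d) (F := fun x s => w s * f (τ + s * (x - τ)))
    (F' := fun x s => (w s * s) * deriv f (τ + s * (x - τ)))
    (isOpen_Ioo.mem_nhds ⟨hc.2, hd.2⟩) ?_ ?_ ?_ ?_ ?_ ?_).2
  · filter_upwards [isOpen_Ioo.mem_nhds (show x₀ ∈ Ioo c d from ⟨hc.2, hd.2⟩)] with x hx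
    exact ((hcont x hx).aestronglyMeasurable measurableSet_Icc).mono_set hsub
  · exact (hcont x₀ ⟨hc.2, hd.2⟩).intervalIntegrable_of_Icc zero_le_one
  · exact (hcont'.aestronglyMeasurable measurableSet_Icc).mono_set hsub
  · refine Eventually.of_forall fun s hs x hx => ?_
    have hs' := hsub hs
    have h1 := hK s hs'
    have h2 := hM _ (hmem x hx s hs')
    rw [norm_mul, norm_mul]
    have h3 : ‖s‖ ≤ 1 := by rw [Real.norm_of_nonneg hs'.1]; exact hs'.2
    calc ‖w s‖ * ‖s‖ * ‖deriv f (τ + s * (x - τ))‖ ≤ ‖w s‖ * 1 * ‖deriv f (τ + s * (x - τ))‖ := by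
          gcongr
      _ ≤ K * M := by
          rw [mul_one]
          exact mul_le_mul h1 h2 (norm_nonneg _) ((norm_nonneg _).trans h1)
  · exact intervalIntegrable_const
  · refine Eventually.of_forall fun s hs x hx => ?_
    have h1 : HasDerivAt (fun x : ℝ => τ + s * (x - τ)) s x := by
      simpa using (((hasDerivAt_id x).sub_const τ).const_mul s).const_add τ
    have h2 := ((hder _ (hcd (hmem x hx s (hsub hs)))).comp x h1).const_mul (w s)
    refine h2.congr_deriv ?_
    ring

/-- Differentiation replaces `f` by `deriv f` and `w s` by `w s * s`. The arbitrary weight makes the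
class of such integrals closed under differentiation, so the induction can run. -/
theorem contDiffOn_integral_comp_segment {a b τ : ℝ} (hτ : τ ∈ Ioo a b) (n : ℕ) :
    ∀ {f w : ℝ → ℝ}, ContDiffOn ℝ ∞ f (Ioo a b) → Continuous w →
      ContDiffOn ℝ n (fun x => ∫ s in (0 : ℝ)..1, w s * f (τ + s * (x - τ))) (Ioo a b) := by
  induction n with
  | zero =>
    intro f w hf hw
    simp only [Nat.cast_zero, contDiffOn_zero]
    exact fun x hx => (hasDerivAt_integral_comp_segment (hf.of_le (by exact_mod_cast le_top)) hw hτ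
      hx).continuousAt.continuousWithinAt
  | succ n ih =>
    intro f w hf hw
    have hder := fun x (hx : x ∈ Ioo a b) =>
      hasDerivAt_integral_comp_segment (hf.of_le (by exact_mod_cast le_top)) hw hτ hx
    rw [Nat.cast_succ, contDiffOn_succ_iff_deriv_of_isOpen isOpen_Ioo]
    refine ⟨fun x hx => (hder x hx).differentiableAt.differentiableWithinAt, by simp, ?_⟩
    refine (ih (hf.deriv_of_isOpen isOpen_Ioo (m := ∞) (by simp))
      (hw.mul continuous_id)).congr fun x hx => (hder x hx).deriv

/-- The divided difference of a smooth function is smooth. -/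
theorem contDiffOn_dslope {f : ℝ → ℝ} {a b τ : ℝ} (hf : ContDiffOn ℝ ∞ f (Ioo a b))
    (hτ : τ ∈ Ioo a b) : ContDiffOn ℝ ∞ (dslope f τ) (Ioo a b) := by
  have hdf : ContDiffOn ℝ ∞ (deriv f) (Ioo a b) := hf.deriv_of_isOpen isOpen_Ioo (by simp)
  -- Hadamard's formula: the fundamental theorem of calculus along the segment from `τ` to `x`. Its
  -- right-hand side makes sense at `x = τ` too.
  have key : ∀ x ∈ Ioo a b,
      dslope f τ x = ∫ s in (0 : ℝ)..1, (1 : ℝ) * deriv f (τ + s * (x - τ)) := by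
    intro x hx
    rcases eq_or_ne x τ with rfl | hne
    · simp
    · have hmem : ∀ s ∈ uIcc (0 : ℝ) 1, τ + s * (x - τ) ∈ Ioo a b := by
        intro s hs
        rw [uIcc_of_le zero_le_one] at hs
        simpa using (convex_Ioo a b).add_smul_sub_mem hτ hx hs
      have h1 : ∀ s ∈ uIcc (0 : ℝ) 1, HasDerivAt (fun s => f (τ + s * (x - τ)))
          (deriv f (τ + s * (x - τ)) * (x - τ)) s := by
        intro s hs
        have h2 : HasDerivAt (fun s : ℝ => τ + s * (x - τ)) (x - τ) s := by
          simpa using ((hasDerivAt_id s).mul_const (x - τ)).const_add τ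
        exact (((hf.differentiableOn (by simp)).differentiableAt
          (isOpen_Ioo.mem_nhds (hmem s hs))).hasDerivAt).comp s h2
      have h3 : ContinuousOn (fun s => deriv f (τ + s * (x - τ)) * (x - τ)) (uIcc (0 : ℝ) 1) :=
        (hdf.continuousOn.comp (by fun_prop) hmem).mul continuousOn_const
      have h4 := intervalIntegral.integral_eq_sub_of_hasDerivAt h1 h3.intervalIntegrable
      rw [intervalIntegral.integral_mul_const] at h4
      rw [dslope_of_ne _ hne, slope_def_field]
      simp only [one_mul, zero_mul, add_zero, add_sub_cancel] at h4 ⊢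
      rw [← h4, mul_div_cancel_right₀ _ (sub_ne_zero.2 hne)]
  refine ContDiffOn.congr ?_ key
  exact contDiffOn_infty.2 fun n => contDiffOn_integral_comp_segment hτ n hdf continuous_const

/-- Leibniz rule for `f = f τ + (x - τ) * dslope f τ`: at `τ` only the term with exactly one
derivative on `x - τ` survives, with binomial coefficient `k + 1`. -/
theorem iteratedDeriv_dslope {f : ℝ → ℝ} {a b τ : ℝ} (hf : ContDiffOn ℝ ∞ f (Ioo a b))
    (hτ : τ ∈ Ioo a b) (k : ℕ) :
    iteratedDeriv (k + 1) f τ = (k + 1) * iteratedDeriv k (dslope f τ) τ := by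
  have hD := contDiffOn_dslope hf hτ
  have hat : ∀ n : ℕ, ContDiffAt ℝ n (dslope f τ) τ := fun n =>
    (hD.contDiffAt (isOpen_Ioo.mem_nhds hτ)).of_le (by exact_mod_cast le_top)
  have h1 : f = (fun _ => f τ) + (fun x => x - τ) * dslope f τ := by
    funext x
    have := sub_smul_dslope f τ x
    simp only [smul_eq_mul] at this
    simp [this]
  have h2 : ContDiffAt ℝ (k + 1 : ℕ) (fun x : ℝ => x - τ) τ := by fun_prop
  conv_lhs => rw [h1]
  rw [iteratedDeriv_add (f := fun _ => f τ) (g := (fun x => x - τ) * dslope f τ) contDiffAt_const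
    (h2.mul (hat _)), iteratedDeriv_mul h2 (hat _),
    Finset.sum_eq_single 1]
  · have : iteratedDeriv 1 (fun x : ℝ => x - τ) τ = 1 := by
      rw [iteratedDeriv_one]; simp
    simp [iteratedDeriv_const, this]
  · intro i hi hne
    rcases i with _ | _ | i
    · simp
    · exact absurd rfl hne
    · have : iteratedDeriv (i + 2) (fun x : ℝ => x - τ) = fun _ => 0 := by
        rw [iteratedDeriv_succ', iteratedDeriv_succ']
        have : deriv (fun x : ℝ => x - τ) = fun _ => 1 := by funext x; simp
        rw [this]
        simp only [deriv_const']
        funext x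
        simp
      rw [this]; simp
  · intro h
    simp at h

/-- Taylor's formula with smooth remainder factor. -/
theorem exists_taylor_factor (m : ℕ) : ∀ {f : ℝ → ℝ} {a b τ : ℝ},
    ContDiffOn ℝ ∞ f (Ioo a b) → τ ∈ Ioo a b →
    ∃ V : ℝ → ℝ, ContDiffOn ℝ ∞ V (Ioo a b) ∧ V τ = iteratedDeriv m f τ / (m.factorial : ℝ) ∧
      ∀ x, f x = ∑ k ∈ Finset.range m, iteratedDeriv k f τ / (k.factorial : ℝ) * (x - τ) ^ k
        + (x - τ) ^ m * V x := by
  induction m with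
  | zero =>
    intro f a b τ hf hτ
    exact ⟨f, hf, by simp, by simp⟩
  | succ m ih =>
    intro f a b τ hf hτ
    -- The coefficients of the divided difference are those of `f` shifted by one. Since `(x - τ) *
    -- dslope f τ x = f x - f τ` holds for all real `x`, so does the resulting formula.
    obtain ⟨V, hV, hVτ, hfac⟩ := ih (contDiffOn_dslope hf hτ) hτ
    have hc : ∀ k : ℕ, iteratedDeriv k (dslope f τ) τ / (k.factorial : ℝ)
        = iteratedDeriv (k + 1) f τ / ((k + 1).factorial : ℝ) := by
      intro k
      rw [iteratedDeriv_dslope hf hτ, Nat.factorial_succ]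
      push_cast
      have : (k : ℝ) + 1 ≠ 0 := by positivity
      field_simp
    refine ⟨V, hV, by rw [hVτ, hc], fun x => ?_⟩
    have := sub_smul_dslope f τ x
    simp only [smul_eq_mul] at this
    rw [Finset.sum_range_succ']
    simp only [← hc]
    rw [eq_comm, sub_eq_iff_eq_add] at this
    rw [this, hfac x, mul_add, Finset.mul_sum]
    simp only [iteratedDeriv_zero, Nat.factorial_zero, Nat.cast_one, div_one, pow_zero, mul_one]
    have : ∀ k, (x - τ) * (iteratedDeriv k (dslope f τ) τ / (k.factorial : ℝ) * (x - τ) ^ k)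
        = iteratedDeriv k (dslope f τ) τ / (k.factorial : ℝ) * (x - τ) ^ (k + 1) := by
      intro k; ring
    simp only [this]
    ring

/-! ### Calculus of finite parts -/

/-- `φ` has an expansion, as `ε → 0+`, into negative powers of `ε` and a multiple of `log ε`, with
constant term `I`. -/
def HasFinitePart (φ : ℝ → ℝ) (I : ℝ) : Prop :=
  ∃ (P : Polynomial ℝ) (d : ℝ),
    Tendsto (fun ε : ℝ => φ ε - (ε⁻¹ * P.eval ε⁻¹ + d * Real.log ε)) (𝓝[>] 0) (𝓝 I)

namespace HasFinitePart

variable {φ χ : ℝ → ℝ} {I J : ℝ}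

theorem of_tendsto (h : Tendsto φ (𝓝[>] 0) (𝓝 I)) : HasFinitePart φ I :=
  ⟨0, 0, by simpa using h⟩

theorem add (hφ : HasFinitePart φ I) (hχ : HasFinitePart χ J) :
    HasFinitePart (fun ε => φ ε + χ ε) (I + J) := by
  obtain ⟨P, d, h⟩ := hφ
  obtain ⟨Q, e, h'⟩ := hχ
  refine ⟨P + Q, d + e, (h.add h').congr fun ε => ?_⟩
  rw [Polynomial.eval_add]
  ring

theorem const_mul (r : ℝ) (hφ : HasFinitePart φ I) : HasFinitePart (fun ε => r * φ ε) (r * I) := by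
  obtain ⟨P, d, h⟩ := hφ
  refine ⟨Polynomial.C r * P, r * d, (h.const_mul r).congr fun ε => ?_⟩
  rw [Polynomial.eval_mul, Polynomial.eval_C]
  ring

theorem sum {ι : Type*} (s : Finset ι) {φ : ι → ℝ → ℝ} {I : ι → ℝ}
    (h : ∀ i ∈ s, HasFinitePart (φ i) (I i)) :
    HasFinitePart (fun ε => ∑ i ∈ s, φ i ε) (∑ i ∈ s, I i) := by
  classical
  induction s using Finset.induction_on with
  | empty => simpa using of_tendsto (φ := fun _ => 0) tendsto_const_nhds
  | insert i s hi ih =>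
    simp only [Finset.sum_insert hi]
    exact (h i (Finset.mem_insert_self i s)).add
      (ih fun j hj => h j (Finset.mem_insert_of_mem hj))

theorem congr' (h : HasFinitePart φ I) (he : φ =ᶠ[𝓝[>] 0] χ) : HasFinitePart χ I := by
  obtain ⟨P, d, h⟩ := h
  refine ⟨P, d, h.congr' ?_⟩
  filter_upwards [he] with ε hε
  rw [hε]

theorem inv_pow_succ (k : ℕ) : HasFinitePart (fun ε => (ε ^ (k + 1))⁻¹) 0 := by
  refine ⟨Polynomial.X ^ k, 0, ?_⟩
  refine (tendsto_const_nhds (x := (0 : ℝ))).congr fun ε => ?_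
  simp [pow_succ, mul_comm]

theorem inv_pow_of_ne_zero {k : ℕ} (hk : k ≠ 0) : HasFinitePart (fun ε => (ε ^ k)⁻¹) 0 := by
  obtain ⟨k, rfl⟩ := Nat.exists_eq_succ_of_ne_zero hk
  exact inv_pow_succ k

theorem hasHadamardFinitePart {u : ℝ → ℝ} {a b t I : ℝ}
    (hl : ∀ ε : ℝ, 0 < ε → ε < t - a → IntervalIntegrable u volume a (t - ε))
    (hr : ∀ ε : ℝ, 0 < ε → ε < b - t → IntervalIntegrable u volume (t + ε) b)
    (h : HasFinitePart (fun ε => (∫ x in a..(t - ε), u x) + ∫ x in (t + ε)..b, u x) I) :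
    HasHadamardFinitePart u a b t I := by
  obtain ⟨P, d, h⟩ := h
  refine ⟨hl, hr, P.natDegree + 1, P.coeff, d, h.congr fun ε => ?_⟩
  rw [Polynomial.eval_eq_sum_range, Finset.mul_sum]
  congr 2
  refine Finset.sum_congr rfl fun k _ => ?_
  rw [pow_succ, mul_inv, inv_pow]
  ring

end HasFinitePart

/-! ### Primitives across the pole -/

/-- A primitive of `x ↦ 1 / x ^ (j + 1)`. -/
noncomputable def polePrimitive : ℕ → ℝ → ℝ
  | 0, x => Real.log x
  | j + 1, x => -(x ^ (j + 1))⁻¹ / (j + 1)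

theorem hasDerivAt_polePrimitive (j : ℕ) {x : ℝ} (hx : x ≠ 0) :
    HasDerivAt (polePrimitive j) (x ^ (j + 1))⁻¹ x := by
  rcases j with _ | j
  · have := Real.hasDerivAt_log hx
    rw [zero_add, pow_one]
    exact this
  · have h := (((hasDerivAt_pow (j + 1) x).inv (pow_ne_zero _ hx)).neg).div_const ((j : ℝ) + 1)
    refine h.congr_deriv ?_
    have : (j : ℝ) + 1 ≠ 0 := by positivity
    simp only [Nat.add_sub_cancel]
    push_cast
    field_simp
    ring

/-- Write `ψ(τ+y) - ψ τ = y D(τ+y)` with `D = dslope ψ τ` smooth and positive near `τ`. For a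
logarithm the two `log ε` cancel and `log D` is continuous. For a power, Taylor expansion of
`D^{-(j+1)}` leaves pure negative powers of `y` plus a continuous remainder. Its value at `τ` is the
same from both sides, so the constant terms cancel in the difference. This cancellation makes the
finite part invariant under a change of variable. -/
theorem hasFinitePart_polePrimitive {ψ : ℝ → ℝ} {α β τ : ℝ} (hψ : ContDiffOn ℝ ∞ ψ (Ioo α β))
    (hτ : τ ∈ Ioo α β) (hd : 0 < deriv ψ τ) (j : ℕ) :
    HasFinitePart (fun ε => polePrimitive j (ψ (τ - ε) - ψ τ) - polePrimitive j (ψ (τ + ε) - ψ τ))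
      0 := by
  have hD := contDiffOn_dslope hψ hτ
  have hDτ : ContinuousAt (dslope ψ τ) τ := (hD.contDiffAt (isOpen_Ioo.mem_nhds hτ)).continuousAt
  have hpos : ∀ᶠ x in 𝓝 τ, 0 < dslope ψ τ x ∧ x ∈ Ioo α β :=
    (hDτ.eventually_const_lt (by simpa using hd)).and (isOpen_Ioo.mem_nhds hτ)
  obtain ⟨δ, hδ, hball⟩ := Metric.eventually_nhds_iff_ball.1 hpos
  rw [Real.ball_eq_Ioo] at hball
  have hτδ : τ ∈ Ioo (τ - δ) (τ + δ) := ⟨by linarith, by linarith⟩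
  have hfac : ∀ x, ψ x - ψ τ = (x - τ) * dslope ψ τ x := fun x => by
    simpa using (sub_smul_dslope ψ τ x).symm
  have htm : Tendsto (fun ε : ℝ => τ - ε) (𝓝[>] 0) (𝓝 τ) := by
    have : Tendsto (fun ε : ℝ => τ - ε) (𝓝 0) (𝓝 (τ - 0)) := by
      exact (continuous_const.sub continuous_id).tendsto 0
    rw [sub_zero] at this
    exact this.mono_left nhdsWithin_le_nhds
  have htp : Tendsto (fun ε : ℝ => τ + ε) (𝓝[>] 0) (𝓝 τ) := by
    have : Tendsto (fun ε : ℝ => τ + ε) (𝓝 0) (𝓝 (τ + 0)) := by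
      exact (continuous_const.add continuous_id).tendsto 0
    rw [add_zero] at this
    exact this.mono_left nhdsWithin_le_nhds
  have hsmall : ∀ᶠ ε : ℝ in 𝓝[>] 0, ε ∈ Ioo 0 δ := Ioo_mem_nhdsGT hδ
  rcases j with _ | j
  · have hlog : ContinuousAt (fun x => Real.log (dslope ψ τ x)) τ :=
      hDτ.log (by simpa using hd.ne')
    have h1 := (hlog.tendsto.comp htm).sub (hlog.tendsto.comp htp)
    rw [sub_self] at h1
    refine (HasFinitePart.of_tendsto h1).congr' ?_
    filter_upwards [hsmall] with ε hε
    have hm := (hball (τ - ε) ⟨by linarith [hε.2], by linarith [hε.1]⟩).1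
    have hp := (hball (τ + ε) ⟨by linarith [hε.1], by linarith [hε.2]⟩).1
    simp only [polePrimitive, hfac, Function.comp]
    rw [Real.log_mul (by linarith [hε.1]) hm.ne', Real.log_mul (by linarith [hε.1]) hp.ne']
    have e1 : τ - ε - τ = -ε := by ring
    have e2 : τ + ε - τ = ε := by ring
    rw [e1, e2, Real.log_neg_eq_log]
    ring
  · have hE : ContDiffOn ℝ ∞ (fun x => (dslope ψ τ x ^ (j + 1))⁻¹) (Ioo (τ - δ) (τ + δ)) :=
      ((hD.mono fun x hx => (hball x hx).2).pow _).inv fun x hx => (pow_pos (hball x hx).1 _).ne'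
    obtain ⟨V, hV, -, hEV⟩ := exists_taylor_factor (j + 1) hE hτδ
    set e : ℕ → ℝ := fun k =>
      iteratedDeriv k (fun x => (dslope ψ τ x ^ (j + 1))⁻¹) τ / (k.factorial : ℝ) with he
    have hVτ : ContinuousAt V τ := (hV.contDiffAt (isOpen_Ioo.mem_nhds hτδ)).continuousAt
    have h1 := (hVτ.tendsto.comp htm).sub (hVτ.tendsto.comp htp)
    rw [sub_self] at h1
    have h2 := HasFinitePart.sum (Finset.range (j + 1))
      (φ := fun k ε => (e k * ((-1) ^ (j + 1 - k) - 1)) * (ε ^ (j + 1 - k))⁻¹) (I := fun _ => 0)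
      (fun k hk => by
        have := (HasFinitePart.inv_pow_of_ne_zero (k := j + 1 - k) (by
          have := Finset.mem_range.1 hk; omega)).const_mul (e k * ((-1) ^ (j + 1 - k) - 1))
        simpa only [mul_zero] using this)
    have h3 := ((HasFinitePart.of_tendsto h1).add h2).const_mul (-1 / ((j : ℝ) + 1))
    simp only [Finset.sum_const_zero, add_zero, mul_zero] at h3
    refine h3.congr' ?_
    filter_upwards [hsmall] with ε hε
    have hε0 : ε ≠ 0 := hε.1.ne'
    -- One expansion for both signs of `y`; it is used at `-ε` and at `ε`.
    have key : ∀ y : ℝ, y ≠ 0 → ((ψ (τ + y) - ψ τ) ^ (j + 1))⁻¹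
        = ∑ k ∈ Finset.range (j + 1), e k * (y ^ (j + 1 - k))⁻¹ + V (τ + y) := by
      intro y hy
      rw [hfac, mul_pow, mul_inv, hEV (τ + y), add_sub_cancel_left, mul_add,
        ← mul_assoc _ (y ^ (j + 1)), inv_mul_cancel₀ (pow_ne_zero _ hy), one_mul, Finset.mul_sum]
      congr 1
      refine Finset.sum_congr rfl fun k hk => ?_
      have hk' := (Finset.mem_range.1 hk).le
      rw [pow_sub₀ y hy hk', mul_inv, inv_inv]
      ring
    simp only [polePrimitive, Function.comp]
    have km := key (-ε) (neg_ne_zero.2 hε0)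
    rw [← sub_eq_add_neg] at km
    rw [km, key ε hε0]
    have : ∑ k ∈ Finset.range (j + 1), (e k * ((-1) ^ (j + 1 - k) - 1)) * (ε ^ (j + 1 - k))⁻¹
        = ∑ k ∈ Finset.range (j + 1), e k * ((-ε) ^ (j + 1 - k))⁻¹
          - ∑ k ∈ Finset.range (j + 1), e k * (ε ^ (j + 1 - k))⁻¹ := by
      rw [← Finset.sum_sub_distrib]
      refine Finset.sum_congr rfl fun k _ => ?_
      rw [neg_pow ε, mul_inv, ← inv_pow (-1 : ℝ), inv_neg, inv_one]
      ring
    rw [this]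
    ring

/-- The singular integrand has a primitive whose jump across the singularity has no constant term,
in whichever smooth increasing parameter the jump is expanded. -/
theorem exists_primitive {g : ℝ → ℝ} {a b t : ℝ} {m : ℕ} (hg : ContDiffOn ℝ ∞ g (Ioo a b))
    (ht : t ∈ Ioo a b) :
    ∃ B : ℝ → ℝ, (∀ x ∈ Ioo a b, x ≠ t → HasDerivAt B (integrand g t m x) x) ∧
      ∀ (ψ : ℝ → ℝ) (α β τ : ℝ), ContDiffOn ℝ ∞ ψ (Ioo α β) → τ ∈ Ioo α β → 0 < deriv ψ τ →
        ψ τ = t → HasFinitePart (fun ε => B (ψ (τ - ε)) - B (ψ (τ + ε))) 0 := by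
  obtain ⟨v, hv, -, hgv⟩ := exists_taylor_factor m hg ht
  set e : ℕ → ℝ := fun k => iteratedDeriv k g t / (k.factorial : ℝ) with he
  have hvB : ∀ x ∈ Ioo a b, HasDerivAt (fun y => ∫ z in t..y, v z) (v x) x := by
    intro x hx
    refine intervalIntegral.integral_hasDerivAt_right ?_ ?_ ?_
    · exact (hv.continuousOn.mono (ordConnected_Ioo.uIcc_subset ht hx)).intervalIntegrable
    · exact hv.continuousOn.stronglyMeasurableAtFilter isOpen_Ioo x hx
    · exact hv.continuousOn.continuousAt (isOpen_Ioo.mem_nhds hx)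
  refine ⟨fun x => ∑ k ∈ Finset.range m, e k * polePrimitive (m - k - 1) (x - t)
    + ∫ z in t..x, v z, ?_, ?_⟩
  · intro x hx hxt
    have hx0 : x - t ≠ 0 := sub_ne_zero.2 hxt
    have h1 : ∀ k ∈ Finset.range m, HasDerivAt (fun x => e k * polePrimitive (m - k - 1) (x - t))
        (e k * ((x - t) ^ (m - k))⁻¹) x := by
      intro k hk
      have hk' : m - k - 1 + 1 = m - k := by have := Finset.mem_range.1 hk; omega
      have := (((hasDerivAt_polePrimitive (m - k - 1) hx0).comp x
        ((hasDerivAt_id x).sub_const t))).const_mul (e k)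
      rw [hk', mul_one] at this
      exact this
    refine ((HasDerivAt.fun_sum h1).add (hvB x hx)).congr_deriv ?_
    rw [integrand, hgv x, add_div, Finset.sum_div, mul_div_cancel_left₀ _ (pow_ne_zero _ hx0)]
    congr 1
    refine Finset.sum_congr rfl fun k hk => ?_
    rw [pow_sub₀ _ hx0 (Finset.mem_range.1 hk).le, mul_inv, inv_inv]
    simp only [he]
    ring
  · intro ψ α β τ hψ hτ hd hψτ
    have hψc : ContinuousAt ψ τ := (hψ.contDiffAt (isOpen_Ioo.mem_nhds hτ)).continuousAt
    have h1 : HasFinitePart (fun ε => (∫ z in t..(ψ (τ - ε)), v z) - ∫ z in t..(ψ (τ + ε)), v z)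
        0 := by
      refine HasFinitePart.of_tendsto ?_
      have hc : ContinuousAt (fun y => ∫ z in t..(ψ y), v z) τ := by
        refine ContinuousAt.comp (g := fun y => ∫ z in t..y, v z) ?_ hψc
        rw [hψτ]
        exact (hvB t ht).continuousAt
      have hcm : Tendsto (fun ε : ℝ => τ - ε) (𝓝[>] 0) (𝓝 τ) := by
        have : Tendsto (fun ε : ℝ => τ - ε) (𝓝 0) (𝓝 (τ - 0)) := by
          exact (continuous_const.sub continuous_id).tendsto 0
        rw [sub_zero] at this
        exact this.mono_left nhdsWithin_le_nhds
      have hcp : Tendsto (fun ε : ℝ => τ + ε) (𝓝[>] 0) (𝓝 τ) := by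
        have : Tendsto (fun ε : ℝ => τ + ε) (𝓝 0) (𝓝 (τ + 0)) := by
          exact (continuous_const.add continuous_id).tendsto 0
        rw [add_zero] at this
        exact this.mono_left nhdsWithin_le_nhds
      have := (hc.tendsto.comp hcm).sub (hc.tendsto.comp hcp)
      rw [sub_self] at this
      exact this
    have h2 := HasFinitePart.sum (Finset.range m)
      (φ := fun k ε => e k * (polePrimitive (m - k - 1) (ψ (τ - ε) - ψ τ)
        - polePrimitive (m - k - 1) (ψ (τ + ε) - ψ τ))) (I := fun _ => 0)
      (fun k _ => by
        simpa only [mul_zero] using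
          (hasFinitePart_polePrimitive hψ hτ hd (m - k - 1)).const_mul (e k))
    have h3 := h2.add h1
    rw [Finset.sum_const_zero, add_zero] at h3
    refine h3.congr' (Eventually.of_forall fun ε => ?_)
    simp only [mul_sub, Finset.sum_sub_distrib, hψτ]
    ring

/-! ### Change of variable in the finite part -/

theorem IsVariableTransformation.strictMonoOn {ψ : ℝ → ℝ} {α β a b : ℝ}
    (hψ : IsVariableTransformation ψ α β a b) : StrictMonoOn ψ (Icc α β) :=
  strictMonoOn_of_deriv_pos (convex_Icc α β) hψ.continuousOn (by
    rw [interior_Icc]; exact hψ.deriv_pos)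

theorem IsVariableTransformation.mem_Ioo {ψ : ℝ → ℝ} {α β a b ξ : ℝ}
    (hψ : IsVariableTransformation ψ α β a b) (hξ : ξ ∈ Ioo α β) : ψ ξ ∈ Ioo a b := by
  have hαβ := (hξ.1.trans hξ.2).le
  rw [← hψ.map_left, ← hψ.map_right]
  exact ⟨hψ.strictMonoOn (left_mem_Icc.2 hαβ) (Ioo_subset_Icc_self hξ) hξ.1,
    hψ.strictMonoOn (Ioo_subset_Icc_self hξ) (right_mem_Icc.2 hαβ) hξ.2⟩

theorem integrableOn_integrand {g : ℝ → ℝ} {a b t : ℝ} {m : ℕ}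
    (hgint : IntegrableOn g (Ioo a b)) {s : Set ℝ} (hs : MeasurableSet s) (hsub : s ⊆ Ioo a b)
    {δ : ℝ} (hδ : 0 < δ) (hst : ∀ x ∈ s, δ ≤ |x - t|) : IntegrableOn (integrand g t m) s := by
  have h := (hgint.mono_set hsub).bdd_mul (c := (δ ^ m)⁻¹) (f := fun x => ((x - t) ^ m)⁻¹)
    (by
      have : Measurable fun x : ℝ => ((x - t) ^ m)⁻¹ := by fun_prop
      exact this.aestronglyMeasurable)
    (by
      refine (ae_restrict_iff' hs).2 (Eventually.of_forall fun x hx => ?_)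
      rw [norm_inv, norm_pow, Real.norm_eq_abs]
      have := hst x hx
      gcongr)
  refine h.congr (Eventually.of_forall fun x => ?_)
  simp only [integrand]
  rw [div_eq_inv_mul]

/-- The Hadamard finite part is invariant under a smooth change of variable. -/
theorem exists_hadamardFinitePart {g ψ : ℝ → ℝ} {a b t α β τ : ℝ} {m : ℕ}
    (hg : ContDiffOn ℝ ∞ g (Ioo a b)) (hgint : IntegrableOn g (Ioo a b))
    (hψ : IsVariableTransformation ψ α β a b) (hτ : τ ∈ Ioo α β) (hψτ : ψ τ = t)
    (hl : ∀ x ∈ Ioo α τ, IntervalIntegrable (transformed (integrand g t m) ψ α β) volume α x)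
    (hr : ∀ x ∈ Ioo τ β, IntervalIntegrable (transformed (integrand g t m) ψ α β) volume x β) :
    ∃ I, HasHadamardFinitePart (integrand g t m) a b t I ∧
      HasHadamardFinitePart (transformed (integrand g t m) ψ α β) α β τ I := by
  have ht : t ∈ Ioo a b := hψτ ▸ hψ.mem_Ioo hτ
  obtain ⟨B, hB, hBψ⟩ := exists_primitive (m := m) hg ht
  set f := integrand g t m with hf
  have hfl : ∀ x ∈ Ioo a t, IntervalIntegrable f volume a x := by
    intro x hx
    rw [intervalIntegrable_iff_integrableOn_Ioo_of_le hx.1.le]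
    refine integrableOn_integrand hgint measurableSet_Ioo
      (Ioo_subset_Ioo_right (hx.2.trans ht.2).le) (sub_pos.2 hx.2) fun y hy => ?_
    rw [abs_sub_comm, abs_of_pos (by linarith [hy.2, hx.2])]
    linarith [hy.2]
  have hfr : ∀ x ∈ Ioo t b, IntervalIntegrable f volume x b := by
    intro x hx
    rw [intervalIntegrable_iff_integrableOn_Ioo_of_le hx.2.le]
    refine integrableOn_integrand hgint measurableSet_Ioo
      (Ioo_subset_Ioo_left (ht.1.trans hx.1).le) (sub_pos.2 hx.1) fun y hy => ?_
    rw [abs_of_pos (by linarith [hy.1, hx.1])]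
    linarith [hy.1]
  have hfcont : ∀ x ∈ Ioo a b, x ≠ t → ContinuousAt f x := fun x hx hxt =>
    (hg.continuousOn.continuousAt (isOpen_Ioo.mem_nhds hx)).div (by fun_prop)
      (pow_ne_zero _ (sub_ne_zero.2 hxt))
  obtain ⟨x₀, hx₀⟩ := nonempty_Ioo.2 ht.1
  obtain ⟨y₀, hy₀⟩ := nonempty_Ioo.2 ht.2
  have hleft : ∀ x ∈ Ioo a t, ∫ y in a..x, f y = (∫ y in a..x₀, f y) - B x₀ + B x := by
    intro x hx
    have hsub : uIcc x₀ x ⊆ Ioo a t := ordConnected_Ioo.uIcc_subset hx₀ hx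
    have hint : IntervalIntegrable f volume x₀ x := (hfl x₀ hx₀).symm.trans (hfl x hx)
    have := intervalIntegral.integral_eq_sub_of_hasDerivAt (fun y hy =>
      hB y ⟨(hsub hy).1, (hsub hy).2.trans ht.2⟩ (hsub hy).2.ne) hint
    rw [← intervalIntegral.integral_add_adjacent_intervals (hfl x₀ hx₀) hint, this]
    ring
  have hright : ∀ x ∈ Ioo t b, ∫ y in x..b, f y = (∫ y in y₀..b, f y) + B y₀ - B x := by
    intro x hx
    have hsub : uIcc x y₀ ⊆ Ioo t b := ordConnected_Ioo.uIcc_subset hx hy₀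
    have hint : IntervalIntegrable f volume x y₀ := (hfr x hx).trans (hfr y₀ hy₀).symm
    have := intervalIntegral.integral_eq_sub_of_hasDerivAt (fun y hy =>
      hB y ⟨ht.1.trans (hsub hy).1, (hsub hy).2⟩ (hsub hy).1.ne') hint
    rw [← intervalIntegral.integral_add_adjacent_intervals hint (hfr y₀ hy₀), this]
    ring
  -- On each side of `t` the integral of `f` is a constant plus or minus `B`. The sum of the two
  -- constants is the finite part, because the jump of `B` contributes none.
  set I := ((∫ y in a..x₀, f y) - B x₀) + ((∫ y in y₀..b, f y) + B y₀) with hI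
  have hconst : HasFinitePart (fun _ => I) I := HasFinitePart.of_tendsto tendsto_const_nhds
  refine ⟨I, HasFinitePart.hasHadamardFinitePart (fun ε h1 h2 => hfl _ ⟨by linarith, by linarith⟩)
    (fun ε h1 h2 => hfr _ ⟨by linarith, by linarith⟩) ?_,
    HasFinitePart.hasHadamardFinitePart (fun ε h1 h2 => hl _ ⟨by linarith, by linarith⟩)
    (fun ε h1 h2 => hr _ ⟨by linarith, by linarith⟩) ?_⟩
  · have h := hconst.add (hBψ (fun x => x) a b t contDiffOn_id ht (by simp) rfl)
    rw [add_zero] at h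
    refine h.congr' ?_
    filter_upwards [Ioo_mem_nhdsGT (lt_min (sub_pos.2 ht.1) (sub_pos.2 ht.2))] with ε hε
    have h1 := hε.2.trans_le (min_le_left _ _)
    have h2 := hε.2.trans_le (min_le_right _ _)
    rw [hleft (t - ε) ⟨by linarith, by linarith [hε.1]⟩,
      hright (t + ε) ⟨by linarith [hε.1], by linarith⟩]
    ring
  · have h := hconst.add (hBψ ψ α β τ hψ.contDiffOn hτ (hψ.deriv_pos τ hτ) hψτ)
    rw [add_zero] at h
    refine h.congr' ?_
    have hmono := hψ.strictMonoOn
    have hψd : ∀ x ∈ Ioo α β, HasDerivAt ψ (deriv ψ x) x := fun x hx =>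
      ((hψ.contDiffOn.differentiableOn (by simp)).differentiableAt
        (isOpen_Ioo.mem_nhds hx)).hasDerivAt
    -- On one side of the pole this is ordinary substitution, up to the endpoint. Thus only the
    -- cut-offs differ: `ψ(τ ± ε)` replaces `t ± ε`, and the jump of `B` has constant term zero in
    -- either parameter.
    have hsubst : ∀ c d, c < d → Icc c d ⊆ Icc α β → τ ∉ Ioo c d →
        IntervalIntegrable f volume (ψ c) (ψ d) →
        IntervalIntegrable (transformed f ψ α β) volume c d →
        ∫ x in c..d, transformed f ψ α β x = ∫ x in (ψ c)..(ψ d), f x := by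
      intro c d hcd hsub hτcd hfi hFi
      have hIoo : Ioo c d ⊆ Ioo α β := by
        have hc := hsub (left_mem_Icc.2 hcd.le)
        have hd := hsub (right_mem_Icc.2 hcd.le)
        exact Ioo_subset_Ioo hc.1 hd.2
      have hψcd : ψ c < ψ d :=
        hmono (hsub (left_mem_Icc.2 hcd.le)) (hsub (right_mem_Icc.2 hcd.le)) hcd
      have heq : ∀ x ∈ Ioo c d, transformed f ψ α β x = (f ∘ ψ) x * deriv ψ x := fun x hx => by
        rw [transformed, indicator_of_mem (hIoo hx)]; rfl
      have heq' : ∫ x in c..d, transformed f ψ α β x = ∫ x in c..d, (f ∘ ψ) x * deriv ψ x := by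
        rw [intervalIntegral.integral_of_le hcd.le, intervalIntegral.integral_of_le hcd.le,
          integral_Ioc_eq_integral_Ioo, integral_Ioc_eq_integral_Ioo]
        exact setIntegral_congr_fun measurableSet_Ioo heq
      rw [heq']
      refine intervalIntegral.integral_comp_mul_deriv''' (f := ψ) (g := f) (f' := deriv ψ) ?_ ?_ ?_
        ?_ ?_
      · rw [uIcc_of_le hcd.le]
        exact hψ.continuousOn.mono hsub
      · rw [min_eq_left hcd.le, max_eq_right hcd.le]
        exact fun x hx => (hψd x (hIoo hx)).hasDerivWithinAt
      · rw [min_eq_left hcd.le, max_eq_right hcd.le]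
        rintro _ ⟨x, hx, rfl⟩
        refine (hfcont _ (hψ.mem_Ioo (hIoo hx)) ?_).continuousWithinAt
        rw [← hψτ]
        intro h
        have := hmono.injOn (Ioo_subset_Icc_self (hIoo hx)) (Ioo_subset_Icc_self hτ) h
        exact hτcd (this ▸ hx)
      · rw [uIcc_of_le hcd.le]
        refine IntegrableOn.mono_set (t := Icc (ψ c) (ψ d)) ?_ ?_
        · rwa [← intervalIntegrable_iff_integrableOn_Icc_of_le hψcd.le]
        · rintro _ ⟨x, hx, rfl⟩
          exact ⟨hmono.monotoneOn (hsub (left_mem_Icc.2 hcd.le)) (hsub hx) hx.1,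
            hmono.monotoneOn (hsub hx) (hsub (right_mem_Icc.2 hcd.le)) hx.2⟩
      · rw [uIcc_of_le hcd.le, integrableOn_Icc_iff_integrableOn_Ioo]
        rw [intervalIntegrable_iff_integrableOn_Ioo_of_le hcd.le] at hFi
        exact hFi.congr_fun heq measurableSet_Ioo
    filter_upwards [Ioo_mem_nhdsGT (lt_min (sub_pos.2 hτ.1) (sub_pos.2 hτ.2))] with ε hε
    have h1 := hε.2.trans_le (min_le_left _ _)
    have h2 := hε.2.trans_le (min_le_right _ _)
    have hεp := hε.1
    have hm : τ - ε ∈ Ioo α β := ⟨by linarith, by linarith [hτ.2]⟩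
    have hp : τ + ε ∈ Ioo α β := ⟨by linarith [hτ.1], by linarith⟩
    have hmt : ψ (τ - ε) ∈ Ioo a t := ⟨(hψ.mem_Ioo hm).1, hψτ ▸
      hmono (Ioo_subset_Icc_self hm) (Ioo_subset_Icc_self hτ) (by linarith)⟩
    have hpt : ψ (τ + ε) ∈ Ioo t b := ⟨hψτ ▸
      hmono (Ioo_subset_Icc_self hτ) (Ioo_subset_Icc_self hp) (by linarith), (hψ.mem_Ioo hp).2⟩
    rw [hsubst α (τ - ε) (by linarith) (Icc_subset_Icc_right (by linarith [hτ.2]))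
        (fun h => by linarith [h.2]) (by rw [hψ.map_left]; exact hfl _ hmt)
        (hl _ ⟨by linarith, by linarith⟩),
      hsubst (τ + ε) β (by linarith) (Icc_subset_Icc_left (by linarith [hτ.1]))
        (fun h => by linarith [h.1]) (by rw [hψ.map_right]; exact hfr _ hpt)
        (hr _ ⟨by linarith, by linarith⟩),
      hψ.map_left, hψ.map_right, hleft _ hmt, hright _ hpt]
    ring

/-! ### Periodic functions with poles at the integers -/

/-- The regular part at `0` of the periodic function `periodicPole p`. -/
noncomputable def poleTail (p : ℕ) (x : ℝ) : ℝ :=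
  ∑' n : ℕ, (((x + (n + 1)) ^ p)⁻¹ + ((x - (n + 1)) ^ p)⁻¹)

/-- The function of period `1` with a pole of order `p` at the integers: `π cot (π x)` for `p = 1`,
and `∑_{l ∈ ℤ} 1 / (x + l) ^ p` for `p ≥ 2`. -/
noncomputable def periodicPole (p : ℕ) (x : ℝ) : ℝ :=
  if p = 1 then Real.pi * (Real.cos (Real.pi * x) / Real.sin (Real.pi * x))
  else ∑' l : ℤ, ((x + l) ^ p)⁻¹

/-- A primitive of `periodicPole (j + 1)`. -/
noncomputable def periodicPolePrimitive : ℕ → ℝ → ℝ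
  | 0, x => Real.log (Real.sin (Real.pi * x))
  | j + 1, x => -periodicPole (j + 1) x / (j + 1)

theorem periodicPole_add_one (p : ℕ) (x : ℝ) : periodicPole p (x + 1) = periodicPole p x := by
  unfold periodicPole
  split_ifs with hp
  · rw [mul_add, mul_one, Real.cos_add_pi, Real.sin_add_pi, neg_div_neg_eq]
  · conv_rhs => rw [← (Equiv.addRight (1 : ℤ)).tsum_eq]
    refine tsum_congr fun l => ?_
    simp only [Equiv.coe_addRight]
    push_cast
    rw [add_assoc, add_comm 1 (l : ℝ)]

theorem periodicPolePrimitive_add_one (j : ℕ) (x : ℝ) :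
    periodicPolePrimitive j (x + 1) = periodicPolePrimitive j x := by
  rcases j with _ | j
  · simp only [periodicPolePrimitive]
    rw [mul_add, mul_one, Real.sin_add_pi, Real.log_neg_eq_log]
  · simp only [periodicPolePrimitive, periodicPole_add_one]

theorem summable_inv_add_int_pow {p : ℕ} (hp : 2 ≤ p) (x : ℝ) :
    Summable fun l : ℤ => ((x + l) ^ p)⁻¹ := by
  have h := (Real.summable_one_div_int_add_rpow x p).2 (by exact_mod_cast hp)
  refine Summable.of_norm (h.congr fun l => ?_)
  rw [Real.rpow_natCast, norm_inv, norm_pow, Real.norm_eq_abs, add_comm, one_div]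

/-- Termwise differentiation on `(-r, r)` with `|x| < r < 1`, where `|y ± (n+1)| ≥ (1-r)(n+1)`. The
differentiated series is therefore dominated by a multiple of `∑ (n+1)^{-(j+2)}`. -/
theorem hasDerivAt_poleTail (j : ℕ) {x : ℝ} (hx : x ∈ Ioo (-1 : ℝ) 1) :
    HasDerivAt (poleTail (j + 1)) (-(j + 1) * poleTail (j + 2) x) x := by
  obtain ⟨r, hxr, hr1⟩ := exists_between (max_lt hx.2 (show -x < 1 by linarith [hx.1]))
  rw [max_lt_iff] at hxr
  have hr0 : 0 < r := by linarith [hxr.1, hxr.2]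
  have hge : ∀ (n : ℕ), ∀ y ∈ Ioo (-r) r,
      (1 - r) * (n + 1) ≤ |y + (n + 1)| ∧ (1 - r) * (n + 1) ≤ |y - (n + 1)| := by
    intro n y hy
    have hn : (0 : ℝ) ≤ n := n.cast_nonneg
    have hrn : 0 ≤ r * n := by positivity
    refine ⟨le_trans ?_ (le_abs_self _), le_trans ?_ (neg_le_abs _)⟩
    · nlinarith [hy.1]
    · nlinarith [hy.2]
  have hpos : ∀ n : ℕ, 0 < (1 - r) * ((n : ℝ) + 1) := fun n =>
    mul_pos (by linarith) (by positivity)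
  have hterm : ∀ (q : ℕ) (n : ℕ), ∀ y ∈ Ioo (-r) r,
      ‖((y + (n + 1)) ^ q)⁻¹ + ((y - (n + 1)) ^ q)⁻¹‖
        ≤ 2 * ((1 - r) ^ q)⁻¹ * (((n + 1 : ℕ) : ℝ) ^ q)⁻¹ := by
    intro q n y hy
    obtain ⟨h1, h2⟩ := hge n y hy
    have e : 2 * ((1 - r) ^ q)⁻¹ * (((n + 1 : ℕ) : ℝ) ^ q)⁻¹
        = (((1 - r) * ((n : ℝ) + 1)) ^ q)⁻¹ + (((1 - r) * ((n : ℝ) + 1)) ^ q)⁻¹ := by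
      rw [mul_pow, mul_inv]; push_cast; ring
    rw [e]
    refine (norm_add_le _ _).trans (add_le_add ?_ ?_)
    · rw [norm_inv, norm_pow, Real.norm_eq_abs]
      exact inv_anti₀ (pow_pos (hpos n) _) (pow_le_pow_left₀ (hpos n).le h1 _)
    · rw [norm_inv, norm_pow, Real.norm_eq_abs]
      exact inv_anti₀ (pow_pos (hpos n) _) (pow_le_pow_left₀ (hpos n).le h2 _)
  have hsum : ∀ q : ℕ, 2 ≤ q →
      Summable fun n : ℕ => 2 * ((1 - r) ^ q)⁻¹ * (((n + 1 : ℕ) : ℝ) ^ q)⁻¹ := fun q hq =>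
    ((summable_nat_add_iff 1).2 (Real.summable_nat_pow_inv.2 (by omega))).mul_left _
  have hder := hasDerivAt_tsum_of_isPreconnected (𝕜 := ℝ)
    (g := fun (n : ℕ) y => ((y + (n + 1)) ^ (j + 1))⁻¹ + ((y - (n + 1)) ^ (j + 1))⁻¹)
    (g' := fun (n : ℕ) y =>
      -((j : ℝ) + 1) * (((y + (n + 1)) ^ (j + 2))⁻¹ + ((y - (n + 1)) ^ (j + 2))⁻¹))
    (u := fun n : ℕ => ‖-((j : ℝ) + 1)‖ * (2 * ((1 - r) ^ (j + 2))⁻¹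
      * (((n + 1 : ℕ) : ℝ) ^ (j + 2))⁻¹))
    (t := Ioo (-r) r) (y₀ := 0) (y := x) ((hsum (j + 2) (by omega)).mul_left _) isOpen_Ioo
    isPreconnected_Ioo ?_ ?_ ⟨by linarith, hr0⟩ ?_ ⟨by linarith [hxr.2], hxr.1⟩
  · refine hder.congr_deriv ?_
    rw [tsum_mul_left]
    rfl
  · intro n y hy
    obtain ⟨h1, h2⟩ := hge n y hy
    have h1' : y + (n + 1) ≠ 0 := abs_pos.1 ((hpos n).trans_le h1)
    have h2' : y - (n + 1) ≠ 0 := abs_pos.1 ((hpos n).trans_le h2)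
    have d : ∀ z : ℝ, z ≠ 0 →
        HasDerivAt (fun z : ℝ => (z ^ (j + 1))⁻¹) (-((j : ℝ) + 1) * (z ^ (j + 2))⁻¹) z := by
      intro z hz
      refine ((hasDerivAt_pow (j + 1) z).inv (pow_ne_zero _ hz)).congr_deriv ?_
      simp only [Nat.add_sub_cancel]
      push_cast
      field_simp
      ring
    have d1 := (d _ h1').comp y ((hasDerivAt_id y).add_const ((n : ℝ) + 1))
    have d2 := (d _ h2').comp y ((hasDerivAt_id y).sub_const ((n : ℝ) + 1))
    refine (d1.add d2).congr_deriv ?_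
    ring
  · intro n y hy
    rw [norm_mul]
    exact mul_le_mul_of_nonneg_left (hterm _ n y hy) (norm_nonneg _)
  -- Convergence at the base point `0`. For a simple pole it relies on pairing `n + 1` with `-(n +
  -- 1)`, whose terms cancel there.
  · rcases Nat.eq_zero_or_pos j with rfl | hj
    · refine (summable_zero (α := ℝ) (β := ℕ)).congr fun n => ?_
      have : ((0 : ℝ) - (n + 1)) = -(0 + ((n : ℝ) + 1)) := by ring
      rw [this, zero_add (1 : ℕ), pow_one, pow_one, inv_neg, add_neg_cancel]
    · exact Summable.of_norm_bounded (hsum (j + 1) (by omega))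
        fun n => hterm (j + 1) n 0 ⟨by linarith, hr0⟩

theorem contDiffOn_poleTail (j : ℕ) : ContDiffOn ℝ ∞ (poleTail (j + 1)) (Ioo (-1) 1) := by
  refine contDiffOn_infty.2 fun n => ?_
  induction n generalizing j with
  | zero =>
    simp only [Nat.cast_zero, contDiffOn_zero]
    exact fun x hx => (hasDerivAt_poleTail j hx).continuousAt.continuousWithinAt
  | succ n ih =>
    rw [Nat.cast_succ, contDiffOn_succ_iff_deriv_of_isOpen isOpen_Ioo]
    refine ⟨fun x hx => (hasDerivAt_poleTail j hx).differentiableAt.differentiableWithinAt,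
      by simp, ?_⟩
    exact (contDiffOn_const.mul (ih (j + 1))).congr fun x hx => (hasDerivAt_poleTail j hx).deriv

/-- For a simple pole this is the partial fraction expansion of the cotangent; for higher order the
terms `l` and `-l` of the series are paired. The point `x = 0` is included because `0⁻¹ = 0`. -/
theorem periodicPole_eq (j : ℕ) {x : ℝ} (hx : x ∈ Ioo (-1 : ℝ) 1) :
    periodicPole (j + 1) x = (x ^ (j + 1))⁻¹ + poleTail (j + 1) x := by
  rcases j with _ | j
  · rcases eq_or_ne x 0 with rfl | hx0
    · simp only [periodicPole, poleTail]
      have : ∀ n : ℕ, (((0 : ℝ) + (n + 1)) ^ (0 + 1))⁻¹ + ((0 - ((n : ℝ) + 1)) ^ (0 + 1))⁻¹ = 0 := by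
        intro n
        have : ((0 : ℝ) - (n + 1)) = -(0 + ((n : ℝ) + 1)) := by ring
        rw [this, zero_add (1 : ℕ), pow_one, pow_one, inv_neg, add_neg_cancel]
      rw [tsum_congr this]
      simp
    · have hxz : (x : ℂ) ∈ Complex.integerComplement := by
        rw [Complex.mem_integerComplement_iff]
        rintro ⟨l, hl⟩
        have hl' : (l : ℝ) = x := by exact_mod_cast hl
        rw [← hl'] at hx hx0
        have h1 : -1 < l := by exact_mod_cast hx.1
        have h2 : l < 1 := by exact_mod_cast hx.2
        have : l = 0 := by omega
        simp [this] at hx0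
      have h := cot_series_rep' hxz
      have h' : (((Real.pi * Real.cot (Real.pi * x) - 1 / x : ℝ)) : ℂ)
          = ((∑' n : ℕ, (1 / (x - ((n : ℝ) + 1)) + 1 / (x + ((n : ℝ) + 1))) : ℝ) : ℂ) := by
        push_cast
        exact h
      have h'' := Complex.ofReal_injective h'
      simp only [periodicPole, poleTail, zero_add, pow_one, if_true]
      rw [← Real.cot_eq_cos_div_sin, ← sub_eq_iff_eq_add', ← one_div, h'']
      exact tsum_congr fun n => by rw [one_div, one_div, add_comm]
  · have hs := summable_inv_add_int_pow (p := j + 2) (by omega) x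
    have h1 : Summable fun n : ℕ => ((x + ((n + 1 : ℤ) : ℝ)) ^ (j + 2))⁻¹ :=
      hs.comp_injective (i := fun n : ℕ => (n + 1 : ℤ)) fun a b hab => by simpa using hab
    have h2 : Summable fun n : ℕ => ((x + ((-(n + 1) : ℤ) : ℝ)) ^ (j + 2))⁻¹ :=
      hs.comp_injective (i := fun n : ℕ => (-(n + 1) : ℤ)) fun a b hab => by simpa using hab
    rw [periodicPole, if_neg (by omega),
      tsum_of_add_one_of_neg_add_one (f := fun l : ℤ => ((x + l) ^ (j + 1 + 1))⁻¹) h1 h2, poleTail,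
      ← sub_eq_iff_eq_add']
    have := h1.tsum_add h2
    push_cast at this ⊢
    simp only [sub_eq_add_neg] at this ⊢
    rw [this]
    simp only [add_zero]
    ring

theorem hasDerivAt_periodicPolePrimitive (j : ℕ) {x : ℝ} (hx : x ∈ Ioo (-1 : ℝ) 1) (hx0 : x ≠ 0) :
    HasDerivAt (periodicPolePrimitive j) (periodicPole (j + 1) x) x := by
  rcases j with _ | j
  · have hsin : Real.sin (Real.pi * x) ≠ 0 := by
      intro h
      rw [Real.sin_eq_zero_iff] at h
      obtain ⟨l, hl⟩ := h
      rw [mul_comm] at hl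
      have hl' := mul_left_cancel₀ Real.pi_ne_zero hl
      rw [← hl'] at hx hx0
      have h1 : -1 < l := by exact_mod_cast hx.1
      have h2 : l < 1 := by exact_mod_cast hx.2
      have : l = 0 := by omega
      simp [this] at hx0
    have h1 : HasDerivAt (fun x => Real.pi * x) Real.pi x := by
      simpa using (hasDerivAt_id x).const_mul Real.pi
    refine ((h1.sin).log hsin).congr_deriv ?_
    rw [periodicPole, if_pos rfl]
    ring
  · have hev : periodicPolePrimitive (j + 1) =ᶠ[𝓝 x]
        fun y => -((y ^ (j + 1))⁻¹ + poleTail (j + 1) y) / (j + 1) := by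
      filter_upwards [isOpen_Ioo.mem_nhds hx] with y hy
      rw [periodicPolePrimitive, periodicPole_eq j hy]
    have h1 := ((hasDerivAt_pow (j + 1) x).inv (pow_ne_zero _ hx0)).add (hasDerivAt_poleTail j hx)
    refine (h1.neg.div_const ((j : ℝ) + 1)).congr_of_eventuallyEq hev |>.congr_deriv ?_
    rw [periodicPole_eq (j + 1) hx]
    simp only [Nat.add_sub_cancel]
    have : (j : ℝ) + 1 ≠ 0 := by positivity
    push_cast
    field_simp
    ring

/-- The logarithm is even, since `Real.log` ignores signs, and has no jump. Otherwise the pole gives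
one multiple of a negative power of `ε`, and the regular part is continuous at `0`, so its jump
tends to `0`. -/
theorem hasFinitePart_periodicPolePrimitive (j : ℕ) {T : ℝ} (hT : 0 < T) :
    HasFinitePart (fun ε => periodicPolePrimitive j (-ε / T) - periodicPolePrimitive j (ε / T))
      0 := by
  rcases j with _ | j
  · refine HasFinitePart.of_tendsto (tendsto_const_nhds.congr fun ε => ?_)
    simp only [periodicPolePrimitive]
    rw [neg_div, mul_neg, Real.sin_neg, Real.log_neg_eq_log, sub_self]
  · have h0 : (0 : ℝ) ∈ Ioo (-1 : ℝ) 1 := by norm_num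
    have hc := (hasDerivAt_poleTail j h0).continuousAt
    have hlim : ∀ r : ℝ, Tendsto (fun ε : ℝ => r * ε) (𝓝[>] 0) (𝓝 0) := fun r => by
      have := (continuous_const_mul r).tendsto 0
      rw [mul_zero] at this
      exact this.mono_left nhdsWithin_le_nhds
    have h1 := (hc.tendsto.comp (hlim (-1 / T))).sub (hc.tendsto.comp (hlim (1 / T)))
    rw [sub_self] at h1
    have h2 := ((HasFinitePart.of_tendsto h1).add ((HasFinitePart.inv_pow_succ j).const_mul
      (T ^ (j + 1) * ((-1) ^ (j + 1) - 1)))).const_mul (-1 / ((j : ℝ) + 1))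
    simp only [mul_zero, add_zero] at h2
    refine h2.congr' ?_
    filter_upwards [Ioo_mem_nhdsGT hT] with ε hε
    have hε1 : ε / T < 1 := (div_lt_one hT).2 hε.2
    have hε0 : 0 < ε / T := div_pos hε.1 hT
    simp only [periodicPolePrimitive, Function.comp]
    have e1 : -1 / T * ε = -(ε / T) := by ring
    have e2 : 1 / T * ε = ε / T := by ring
    have e3 : -ε / T = -(ε / T) := neg_div _ _
    rw [e3, e1, e2, periodicPole_eq j ⟨by linarith, by linarith⟩,
      periodicPole_eq j ⟨by linarith, hε1⟩, neg_pow (ε / T), mul_inv, ← inv_pow (-1 : ℝ), inv_neg,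
      inv_one, div_pow, inv_div]
    ring

theorem periodicPole_zero_of_odd {p : ℕ} (hp : Odd p) : periodicPole p 0 = 0 := by
  unfold periodicPole
  split_ifs with h1
  · simp
  · have h : ∑' l : ℤ, (((0 : ℝ) + l) ^ p)⁻¹ = -∑' l : ℤ, (((0 : ℝ) + l) ^ p)⁻¹ := by
      conv_lhs => rw [← (Equiv.neg ℤ).tsum_eq]
      rw [← tsum_neg]
      refine tsum_congr fun l => ?_
      simp only [Equiv.neg_apply, zero_add]
      push_cast
      rw [hp.neg_pow, inv_neg]
    linarith

/-- The convention `0⁻¹ = 0` drops the term `l = 0`, so the value at the pole is the sum over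
nonzero integers. -/
theorem periodicPole_zero_of_even {p : ℕ} (hp : Even p) (hp2 : 2 ≤ p) :
    periodicPole p 0 = 2 * (riemannZeta p).re := by
  have h := two_mul_riemannZeta_eq_tsum_int_inv_pow_of_even hp2 hp
  have h' : ∑' l : ℤ, ((l : ℂ) ^ p)⁻¹ = ((∑' l : ℤ, ((l : ℝ) ^ p)⁻¹ : ℝ) : ℂ) := by
    push_cast
    rfl
  rw [h'] at h
  have : 2 * (riemannZeta p).re = ∑' l : ℤ, ((l : ℝ) ^ p)⁻¹ := by
    have := congrArg Complex.re h
    rw [Complex.ofReal_re, Complex.mul_re] at this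
    simpa using this
  rw [periodicPole, if_neg (by omega), this]
  simp only [zero_add]

/-- Every integer is uniquely `l n + j` with `0 ≤ j < n`, so the double sum over `j` and `l` of
`(j/n + l)^{-p}` rearranges to `n^p` times the sum over all integers. For `p = 1`, where the series
is not absolutely convergent, the reflection `j ↦ n - j` and the oddness of the cotangent give zero
on both sides. -/
theorem sum_periodicPole {p n : ℕ} (hp : 1 ≤ p) (hn : 1 ≤ n) :
    ∑ j ∈ Finset.range n, periodicPole p (j / n) = (n : ℝ) ^ p * periodicPole p 0 := by
  rcases eq_or_ne p 1 with rfl | hp1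
  · rw [periodicPole_zero_of_odd odd_one, mul_zero]
    obtain ⟨n, rfl⟩ : ∃ k, n = k + 1 := ⟨n - 1, by omega⟩
    rw [Finset.sum_range_succ', Nat.cast_zero, zero_div, periodicPole_zero_of_odd odd_one, add_zero]
    have h : ∑ j ∈ Finset.range n, periodicPole 1 ((j + 1 : ℕ) / (n + 1 : ℕ))
        = -∑ j ∈ Finset.range n, periodicPole 1 ((j + 1 : ℕ) / (n + 1 : ℕ)) := by
      conv_lhs => rw [← Finset.sum_range_reflect]
      rw [← Finset.sum_neg_distrib]
      refine Finset.sum_congr rfl fun j hj => ?_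
      have hj' := Finset.mem_range.1 hj
      have e : ((n - 1 - j + 1 : ℕ) : ℝ) / (n + 1 : ℕ) = 1 - (j + 1 : ℕ) / (n + 1 : ℕ) := by
        have : n - 1 - j + 1 = n - j := by omega
        rw [this, Nat.cast_sub hj'.le]
        push_cast
        field_simp
        ring
      rw [e]
      simp only [periodicPole, if_true]
      rw [mul_sub, mul_one, Real.cos_pi_sub, Real.sin_pi_sub]
      ring
    linarith
  · have hp2 : 2 ≤ p := by omega
    have hn0 : (n : ℝ) ≠ 0 := by positivity
    have : NeZero n := ⟨by omega⟩
    have hs := summable_inv_add_int_pow hp2 0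
    simp only [zero_add] at hs
    have hs' : Summable fun c : Fin n × ℤ =>
        (((Int.divModEquiv n).symm ((Equiv.prodComm (Fin n) ℤ) c) : ℝ) ^ p)⁻¹ :=
      (Equiv.prodComm _ _).summable_iff.2 ((Int.divModEquiv n).symm.summable_iff.2 hs)
    simp only [periodicPole, if_neg hp1, zero_add]
    rw [← (Int.divModEquiv n).symm.tsum_eq, ← (Equiv.prodComm _ _).tsum_eq,
      hs'.tsum_prod, tsum_fintype, Finset.mul_sum,
      Finset.sum_range]
    refine Finset.sum_congr rfl fun j _ => ?_
    rw [← tsum_mul_left]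
    refine tsum_congr fun l => ?_
    simp only [Equiv.prodComm_apply, Prod.swap_prod_mk, Int.divModEquiv_symm_apply]
    push_cast
    have : (j : ℝ) / n + l = (l * n + j) / n := by field_simp; ring
    rw [this, div_pow, inv_div, div_eq_mul_inv]

/-! ### Euler-Maclaurin and the trapezoidal rule -/

theorem continuous_normalizedBernoulli (k : ℕ) :
    Continuous fun y : ℝ => bernoulliFun k y / (k.factorial : ℝ) :=
  (continuous_bernoulliFun k).div_const _

/-- One cell of the Euler-Maclaurin formula. -/
theorem integral_bernoulli_cell {u u' : ℝ → ℝ} {A h : ℝ} {s : Set ℝ} (hs : s.Countable)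
    (hh : 0 < h) (hu : ContinuousOn u (Icc A (A + h)))
    (hd : ∀ x ∈ Ioo A (A + h) \ s, HasDerivAt u (u' x) x)
    (hi : IntervalIntegrable u' volume A (A + h)) (k : ℕ) :
    ∫ x in A..(A + h), bernoulliFun k ((x - A) / h) / (k.factorial : ℝ) * u x
      = h * (bernoulliFun (k + 1) 1 / ((k + 1).factorial : ℝ) * u (A + h)
          - bernoulliFun (k + 1) 0 / ((k + 1).factorial : ℝ) * u A)
        - h * ∫ x in A..(A + h), bernoulliFun (k + 1) ((x - A) / h) / ((k + 1).factorial : ℝ)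
            * u' x := by
  have hAh : A ≤ A + h := by linarith
  have hbc : ∀ k : ℕ, Continuous fun x : ℝ => bernoulliFun k ((x - A) / h) / (k.factorial : ℝ) :=
    fun k => (continuous_normalizedBernoulli k).comp (by fun_prop : Continuous fun x => (x - A) / h)
  have hbd : ∀ x : ℝ, HasDerivAt
      (fun x : ℝ => bernoulliFun (k + 1) ((x - A) / h) / ((k + 1).factorial : ℝ))
      (bernoulliFun k ((x - A) / h) / (k.factorial : ℝ) / h) x := by
    intro x
    have h1 : HasDerivAt (fun x : ℝ => (x - A) / h) (1 / h) x :=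
      ((hasDerivAt_id x).sub_const A).div_const h
    have h2 := ((hasDerivAt_bernoulliFun (k + 1) ((x - A) / h)).comp x h1).div_const
      ((k + 1).factorial : ℝ)
    refine h2.congr_deriv ?_
    rw [Nat.factorial_succ]
    simp only [Nat.add_sub_cancel]
    have : ((k : ℝ) + 1) ≠ 0 := by positivity
    push_cast
    field_simp
  have hI1 : IntervalIntegrable (fun x => bernoulliFun k ((x - A) / h) / (k.factorial : ℝ) / h * u x)
      volume A (A + h) := by
    refine ContinuousOn.intervalIntegrable ?_
    rw [uIcc_of_le hAh]
    exact ((hbc k).div_const h).continuousOn.mul hu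
  have hI2 : IntervalIntegrable (fun x =>
      bernoulliFun (k + 1) ((x - A) / h) / ((k + 1).factorial : ℝ) * u' x) volume A (A + h) :=
    hi.continuousOn_mul (hbc (k + 1)).continuousOn
  -- Integration by parts: the rescaled `B_{k+1}/(k+1)!` has derivative `B_k/k!` divided by `h`.
  -- This is where the factor `h` comes from.
  have key := integral_eq_of_hasDerivAt_off_countable_of_le
    (fun x => bernoulliFun (k + 1) ((x - A) / h) / ((k + 1).factorial : ℝ) * u x) _ hAh hs
    ((hbc (k + 1)).continuousOn.mul hu) (fun x hx => (hbd x).mul (hd x hx)) (hI1.add hI2)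
  rw [intervalIntegral.integral_add hI1 hI2, add_sub_cancel_left, sub_self, zero_div,
    div_self hh.ne'] at key
  have e : ∫ x in A..(A + h), bernoulliFun k ((x - A) / h) / (k.factorial : ℝ) * u x
      = h * ∫ x in A..(A + h), bernoulliFun k ((x - A) / h) / (k.factorial : ℝ) / h * u x := by
    rw [← intervalIntegral.integral_const_mul]
    refine intervalIntegral.integral_congr fun x _ => ?_
    field_simp
  rw [e, eq_sub_of_add_eq key]
  ring

/-- The trapezoidal rule has error `O(h ^ q)` for functions whose derivatives of order `< q` are
continuous with equal values at the two end points, and whose derivative of order `q` is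
integrable. -/
theorem exists_trapezoidal_error_le {S : ℕ → ℝ → ℝ} {A T : ℝ} {q : ℕ} {s : Set ℝ}
    (hs : s.Countable) (hT : 0 < T) (hq : 1 ≤ q)
    (hc : ∀ k < q, ContinuousOn (S k) (Icc A (A + T)))
    (hd : ∀ k < q, ∀ x ∈ Ioo A (A + T) \ s, HasDerivAt (S k) (S (k + 1) x) x)
    (hper : ∀ k < q, S k (A + T) = S k A) (hi : IntervalIntegrable (S q) volume A (A + T)) :
    ∃ C : ℝ, ∀ n : ℕ, 1 ≤ n →
      |T / n * ∑ j ∈ Finset.range n, S 0 (A + j * (T / n)) - ∫ x in A..(A + T), S 0 x|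
        ≤ C * (T / n) ^ q := by
  obtain ⟨M, hM⟩ := (isCompact_Icc (a := (0 : ℝ)) (b := 1)).exists_bound_of_continuousOn
    (continuous_normalizedBernoulli q).continuousOn
  refine ⟨M * ∫ x in A..(A + T), |S q x|, fun n hn => ?_⟩
  have hn0 : (0 : ℝ) < n := by exact_mod_cast hn
  set h : ℝ := T / n with hh
  have hpos : 0 < h := div_pos hT hn0
  have hnh : n * h = T := by rw [hh]; field_simp
  have hle : ∀ j ≤ n, A + j * h ≤ A + T := by
    intro j hj
    have : (j : ℝ) ≤ n := by exact_mod_cast hj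
    nlinarith
  have hge : ∀ j : ℕ, A ≤ A + j * h := fun j => by
    have : (0 : ℝ) ≤ j * h := by positivity
    linarith
  have hnext : ∀ j : ℕ, A + (j + 1 : ℕ) * h = A + j * h + h := fun j => by push_cast; ring
  have hii : ∀ k ≤ q, IntervalIntegrable (S k) volume A (A + T) := by
    intro k hk
    rcases hk.eq_or_lt with rfl | hk
    · exact hi
    · refine ContinuousOn.intervalIntegrable ?_
      rw [uIcc_of_le (by linarith)]
      exact hc k hk
  have hcell : ∀ k ≤ q, ∀ j < n,
      IntervalIntegrable (S k) volume (A + j * h) (A + (j + 1 : ℕ) * h) := by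
    intro k hk j hj
    refine (hii k hk).mono_set ?_
    rw [uIcc_of_le (by rw [hnext]; linarith), uIcc_of_le (by linarith)]
    exact Icc_subset_Icc (hge j) (hle _ hj)
  set R : ℕ → ℝ := fun k => ∑ j ∈ Finset.range n, ∫ x in (A + j * h)..(A + (j + 1 : ℕ) * h),
    bernoulliFun k ((x - (A + j * h)) / h) / (k.factorial : ℝ) * S k x with hR
  have hcellk : ∀ k < q, ∀ j < n, ∫ x in (A + j * h)..(A + (j + 1 : ℕ) * h),
        bernoulliFun k ((x - (A + j * h)) / h) / (k.factorial : ℝ) * S k x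
      = h * (bernoulliFun (k + 1) 1 / ((k + 1).factorial : ℝ) * S k (A + (j + 1 : ℕ) * h)
          - bernoulliFun (k + 1) 0 / ((k + 1).factorial : ℝ) * S k (A + j * h))
        - h * ∫ x in (A + j * h)..(A + (j + 1 : ℕ) * h),
          bernoulliFun (k + 1) ((x - (A + j * h)) / h) / ((k + 1).factorial : ℝ) * S (k + 1) x := by
    intro k hk j hj
    have hle' := hle (j + 1) hj
    have hi' := hcell (k + 1) hk j hj
    rw [hnext] at hle' hi' ⊢
    refine integral_bernoulli_cell hs hpos ((hc k hk).mono (Icc_subset_Icc (hge j) hle'))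
      (fun x hx => hd k hk x ⟨Ioo_subset_Ioo (hge j) hle' hx.1, hx.2⟩) hi' k
  have htel : ∀ k < q, ∑ j ∈ Finset.range n, (S k (A + (j + 1 : ℕ) * h) - S k (A + j * h)) = 0 := by
    intro k hk
    rw [Finset.sum_range_sub (fun j : ℕ => S k (A + j * h)), hnh, hper k hk]
    simp
  have hR0 : R 0 = ∫ x in A..(A + T), S 0 x := by
    simp only [hR, bernoulliFun_zero, Nat.factorial_zero, Nat.cast_one, div_one, one_mul]
    rw [intervalIntegral.sum_integral_adjacent_intervals (a := fun j : ℕ => A + j * h)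
      (fun j hj => hcell 0 (Nat.zero_le _) j hj), hnh]
    simp
  have hR1 : R 0 = h * ∑ j ∈ Finset.range n, S 0 (A + j * h) - h * R 1 := by
    simp only [hR]
    rw [Finset.sum_congr rfl fun j hj => hcellk 0 (by omega) j (Finset.mem_range.1 hj),
      Finset.sum_sub_distrib, ← Finset.mul_sum, ← Finset.mul_sum]
    congr 2
    have h0 := htel 0 (by omega)
    -- Since `B_1(1) = 1/2` and `B_1(0) = -1/2`, each cell contributes the mean of its end values:
    -- the left value plus half an increment. The increments telescope to zero by periodicity.
    have : ∀ j : ℕ, bernoulliFun (0 + 1) 1 / ((0 + 1).factorial : ℝ) * S 0 (A + (j + 1 : ℕ) * h)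
        - bernoulliFun (0 + 1) 0 / ((0 + 1).factorial : ℝ) * S 0 (A + j * h)
        = 1 / 2 * (S 0 (A + (j + 1 : ℕ) * h) - S 0 (A + j * h)) + S 0 (A + j * h) := by
      intro j
      rw [zero_add, bernoulliFun_one, bernoulliFun_one]
      simp only [Nat.factorial_one, Nat.cast_one]
      ring
    rw [Finset.sum_congr rfl fun j _ => this j, Finset.sum_add_distrib, ← Finset.mul_sum, h0]
    ring
  -- For index at least two the Bernoulli polynomial has equal values at `0` and `1`, so the
  -- boundary terms telescope. Each further integration by parts gains a factor `h` and nothing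
  -- else.
  have hRs : ∀ k < q, 1 ≤ k → R k = -h * R (k + 1) := by
    intro k hk hk1
    simp only [hR]
    rw [Finset.sum_congr rfl fun j hj => hcellk k hk j (Finset.mem_range.1 hj),
      Finset.sum_sub_distrib, ← Finset.mul_sum, ← Finset.mul_sum,
      bernoulliFun_endpoints_eq_of_ne_one (by omega)]
    simp only [← mul_sub]
    rw [← Finset.mul_sum, htel k hk]
    ring
  have hRq : ∀ k ≤ q, 1 ≤ k → |h * R 1| = h ^ k * |R k| := by
    intro k
    induction k with
    | zero => intro _ h1; omega
    | succ k ih =>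
      intro hk _
      rcases Nat.eq_zero_or_pos k with rfl | hk0
      · rw [abs_mul, abs_of_pos hpos, zero_add, pow_one]
      · rw [ih (by omega) hk0, hRs k hk hk0, abs_mul, abs_neg, abs_of_pos hpos]
        ring
  have herr : |R q| ≤ M * ∫ x in A..(A + T), |S q x| := by
    have habs : ∀ j < n, IntervalIntegrable (fun x => |S q x|) volume (A + j * h)
        (A + (j + 1 : ℕ) * h) := fun j hj => (hcell q le_rfl j hj).abs
    rw [show (∫ x in A..(A + T), |S q x|)
        = ∑ j ∈ Finset.range n, ∫ x in (A + j * h)..(A + (j + 1 : ℕ) * h), |S q x| by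
      rw [intervalIntegral.sum_integral_adjacent_intervals (a := fun j : ℕ => A + j * h)
        (fun j hj => habs j hj), hnh]
      simp, Finset.mul_sum]
    refine (Finset.abs_sum_le_sum_abs _ _).trans (Finset.sum_le_sum fun j hj => ?_)
    have hj' := Finset.mem_range.1 hj
    have hjle : A + j * h ≤ A + (j + 1 : ℕ) * h := by rw [hnext]; linarith
    rw [← intervalIntegral.integral_const_mul, ← Real.norm_eq_abs]
    refine intervalIntegral.norm_integral_le_of_norm_le hjle
      (Eventually.of_forall fun x hx => ?_) ((habs j hj').const_mul M)
    rw [norm_mul, Real.norm_eq_abs (S q x)]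
    refine mul_le_mul_of_nonneg_right (hM _ ⟨?_, ?_⟩) (abs_nonneg _)
    · exact div_nonneg (by linarith [hx.1]) hpos.le
    · rw [div_le_one hpos]
      have := hx.2
      rw [hnext] at this
      linarith
  have : h * ∑ j ∈ Finset.range n, S 0 (A + j * h) - ∫ x in A..(A + T), S 0 x = h * R 1 := by
    rw [← hR0, hR1]; ring
  rw [this, hRq q le_rfl hq, mul_comm]
  exact mul_le_mul_of_nonneg_right herr (pow_nonneg hpos.le _)

/-! ### The periodization condition as a local condition at the endpoints -/

theorem continuousOn_iteratedDeriv {f : ℝ → ℝ} {U : Set ℝ} (hU : IsOpen U)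
    (hf : ContDiffOn ℝ ∞ f U) (k : ℕ) : ContinuousOn (iteratedDeriv k f) U :=
  (hf.continuousOn_iteratedDerivWithin (m := k) (by exact_mod_cast le_top) hU.uniqueDiffOn).congr
    fun _ hx => (iteratedDerivWithin_of_isOpen hU hx).symm

/-- All derivatives of order `< q` tend to `0` along `l`, and the derivative of order `q` is
integrable along `l`. -/
structure VanishesAlong (F : ℝ → ℝ) (l : Filter ℝ) (q : ℕ) : Prop where
  tendsto : ∀ i < q, Tendsto (iteratedDeriv i F) l (𝓝 0)
  integrable : IntegrableAtFilter (iteratedDeriv q F) l volume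

namespace VanishesAlong

variable {F w : ℝ → ℝ} {l : Filter ℝ} {q : ℕ}

theorem congr {F₁ : ℝ → ℝ} {U : Set ℝ} (h : VanishesAlong F l q) (hU : IsOpen U) (hUl : U ∈ l)
    (he : EqOn F F₁ U) : VanishesAlong F₁ l q := by
  have hder := fun i => he.iteratedDeriv_of_isOpen hU i
  refine ⟨fun i hi => (h.tendsto i hi).congr' ?_, ?_⟩
  · filter_upwards [hUl] with x hx using hder i hx
  · obtain ⟨s, hs, hsi⟩ := h.integrable
    refine ⟨s ∩ U, inter_mem hs hUl, ?_⟩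
    have h1 : IntegrableOn (iteratedDeriv q F) (s ∩ U) := hsi.mono_set inter_subset_left
    refine Integrable.congr h1 ?_
    have h2 : ∀ᵐ x ∂(volume.restrict U), iteratedDeriv q F x = iteratedDeriv q F₁ x :=
      (ae_restrict_iff' hU.measurableSet).2 (Eventually.of_forall fun x hx => hder q hx)
    exact ae_mono (Measure.restrict_mono inter_subset_right le_rfl) h2

/-- Multiplication by a function with bounded derivatives. -/
theorem mul [l.IsMeasurablyGenerated] {U : Set ℝ} (h : VanishesAlong F l q)
    (hl : (volume : Measure ℝ).FiniteAtFilter l) (hU : IsOpen U) (hUl : U ∈ l)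
    (hF : ContDiffOn ℝ ∞ F U) (hw : ContDiffOn ℝ ∞ w U)
    (hb : ∀ i ≤ q, ∃ M, ∀ x ∈ U, |iteratedDeriv i w x| ≤ M) :
    VanishesAlong (F * w) l q := by
  have hat : ∀ {f : ℝ → ℝ}, ContDiffOn ℝ ∞ f U → ∀ (n : ℕ), ∀ x ∈ U, ContDiffAt ℝ n f x :=
    fun hf n x hx => (hf.contDiffAt (hU.mem_nhds hx)).of_le (by exact_mod_cast le_top)
  have hterm : ∀ i < q, ∀ j ≤ q, ∀ c : ℝ,
      Tendsto (fun x => c * iteratedDeriv i F x * iteratedDeriv j w x) l (𝓝 0) := by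
    intro i hi j hj c
    obtain ⟨M, hM⟩ := hb j hj
    have h1 := (h.tendsto i hi).const_mul c
    rw [mul_zero] at h1
    refine h1.zero_mul_isBoundedUnder_le (isBoundedUnder_of_eventually_le (a := M) ?_)
    filter_upwards [hUl] with x hx using hM x hx
  have hleib : ∀ k, EqOn (fun x => ∑ i ∈ Finset.range (k + 1),
      (k.choose i : ℝ) * iteratedDeriv i F x * iteratedDeriv (k - i) w x)
      (iteratedDeriv k (F * w)) U := fun k x hx =>
    (iteratedDeriv_mul (hat hF k x hx) (hat hw k x hx)).symm
  refine ⟨fun k hk => ?_, ?_⟩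
  · have h1 := tendsto_finsetSum (Finset.range (k + 1)) fun i hi =>
      hterm i (by have := Finset.mem_range.1 hi; omega) (k - i) (by omega) (k.choose i)
    rw [Finset.sum_const_zero] at h1
    refine h1.congr' ?_
    filter_upwards [hUl] with x hx using hleib k hx
  · have hterm' : ∀ i ∈ Finset.range (q + 1), IntegrableAtFilter
        (fun x => (q.choose i : ℝ) * iteratedDeriv i F x * iteratedDeriv (q - i) w x) l volume := by
      intro i hi
      have hmeas : ∀ {f : ℝ → ℝ}, ContDiffOn ℝ ∞ f U → ∀ k, AEStronglyMeasurable
          (iteratedDeriv k f) (volume.restrict U) := fun hf k =>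
        (continuousOn_iteratedDeriv hU hf k).aestronglyMeasurable hU.measurableSet
      -- Leibniz terms with `i < q` tend to zero, hence are integrable along a filter of finite
      -- measure. In the term `i = q` an integrable function is multiplied by the bounded `w`.
      rcases (Nat.lt_succ_iff.1 (Finset.mem_range.1 hi)).lt_or_eq with hlt | rfl
      · exact Tendsto.integrableAtFilter
          ⟨U, hUl, ((hmeas hF i).const_mul _).mul (hmeas hw (q - i))⟩ hl
          (hterm i hlt (q - i) (by omega) _)
      · obtain ⟨s, hs, hsi⟩ := h.integrable
        obtain ⟨M, hM⟩ := hb 0 (Nat.zero_le _)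
        refine ⟨s ∩ U, inter_mem hs hUl, ?_⟩
        have h1 : IntegrableOn (iteratedDeriv i F) (s ∩ U) := hsi.mono_set inter_subset_left
        have hm : volume.restrict (s ∩ U) ≤ volume.restrict U :=
          Measure.restrict_mono inter_subset_right le_rfl
        have h2 := Integrable.bdd_mul (c := M) h1 ((hmeas hw 0).mono_measure hm)
          (ae_mono hm ((ae_restrict_iff' hU.measurableSet).2
            (Eventually.of_forall fun x hx => hM x hx)))
        refine h2.congr (Eventually.of_forall fun x => ?_)
        simp only [Nat.choose_self, Nat.cast_one, one_mul, Nat.sub_self]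
        ring
    have hsum : IntegrableAtFilter (fun x => ∑ i ∈ Finset.range (q + 1),
        (q.choose i : ℝ) * iteratedDeriv i F x * iteratedDeriv (q - i) w x) l volume := by
      choose! s hs hsi using hterm'
      refine ⟨⋂ i ∈ Finset.range (q + 1), s i, (biInter_finset_mem _).2 hs, ?_⟩
      exact integrable_finsetSum _ fun i hi =>
        (hsi i hi).mono_set (biInter_subset_of_mem (Finset.mem_coe.2 hi))
    obtain ⟨s, hs, hsi⟩ := hsum
    refine ⟨s ∩ U, inter_mem hs hUl, ?_⟩
    have h1 := hsi.mono_set (inter_subset_left (s := s) (t := U))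
    refine Integrable.congr h1 ?_
    exact ae_mono (Measure.restrict_mono inter_subset_right le_rfl)
      ((ae_restrict_iff' hU.measurableSet).2 (Eventually.of_forall fun x hx => hleib q hx))

theorem intervalIntegrable_left {α τ : ℝ} (h : VanishesAlong F (𝓝[>] α) q)
    (hF : ContDiffOn ℝ ∞ F (Ioo α τ)) {d : ℝ} (hd : d ∈ Ioo α τ) :
    IntervalIntegrable (iteratedDeriv q F) volume α d := by
  obtain ⟨s, hs, hsi⟩ := h.integrable
  obtain ⟨e, he, hes⟩ := (mem_nhdsGT_iff_exists_Ioo_subset' hd.1).1 hs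
  obtain ⟨c, hc⟩ := nonempty_Ioo.2 (lt_min (mem_Ioi.1 he) (hd.1.trans hd.2))
  have hce := hc.2.trans_le (min_le_left _ _)
  have hcτ := hc.2.trans_le (min_le_right _ _)
  refine IntervalIntegrable.trans (b := c) ?_ ?_
  · rw [intervalIntegrable_iff_integrableOn_Ioo_of_le hc.1.le]
    exact hsi.mono_set ((Ioo_subset_Ioo_right hce.le).trans hes)
  · exact ((continuousOn_iteratedDeriv isOpen_Ioo hF q).mono
      (ordConnected_Ioo.uIcc_subset ⟨hc.1, hcτ⟩ hd)).intervalIntegrable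

theorem intervalIntegrable_right {β τ : ℝ} (h : VanishesAlong F (𝓝[<] β) q)
    (hF : ContDiffOn ℝ ∞ F (Ioo τ β)) {c : ℝ} (hc : c ∈ Ioo τ β) :
    IntervalIntegrable (iteratedDeriv q F) volume c β := by
  obtain ⟨s, hs, hsi⟩ := h.integrable
  obtain ⟨e, he, hes⟩ := (mem_nhdsLT_iff_exists_Ioo_subset' hc.2).1 hs
  obtain ⟨d, hd⟩ := nonempty_Ioo.2 (max_lt (mem_Iio.1 he) (hc.1.trans hc.2))
  have hde := (le_max_left _ _).trans_lt hd.1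
  have hdτ := (le_max_right _ _).trans_lt hd.1
  refine IntervalIntegrable.trans (b := d) ?_ ?_
  · exact ((continuousOn_iteratedDeriv isOpen_Ioo hF q).mono
      (ordConnected_Ioo.uIcc_subset hc ⟨hdτ, hd.2⟩)).intervalIntegrable
  · rw [intervalIntegrable_iff_integrableOn_Ioo_of_le hd.2.le]
    exact hsi.mono_set ((Ioo_subset_Ioo_left hde.le).trans hes)

end VanishesAlong

theorem periodicExtension_eq {F : ℝ → ℝ} {α β ξ : ℝ} (hξ : ξ ∈ Ico α β) :
    periodicExtension F α β ξ = F ξ := by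
  have hpos : 0 < β - α := by linarith [hξ.1, hξ.2]
  have : Int.fract ((ξ - α) / (β - α)) = (ξ - α) / (β - α) :=
    Int.fract_eq_self.2 ⟨div_nonneg (by linarith [hξ.1]) hpos.le,
      (div_lt_one hpos).2 (by linarith [hξ.2])⟩
  rw [periodicExtension, this, mul_div_cancel₀ _ hpos.ne', add_sub_cancel]

theorem periodicExtension_add_int_mul {F : ℝ → ℝ} {α β : ℝ} (hαβ : α < β) (ξ : ℝ) (k : ℤ) :
    periodicExtension F α β (ξ + k * (β - α)) = periodicExtension F α β ξ := by
  have : (ξ + k * (β - α) - α) / (β - α) = (ξ - α) / (β - α) + k := by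
    have : β - α ≠ 0 := (sub_pos.2 hαβ).ne'
    field_simp
    ring
  rw [periodicExtension, periodicExtension, this, Int.fract_add_intCast]

theorem iteratedDeriv_periodicExtension_add_int_mul {F : ℝ → ℝ} {α β : ℝ} (hαβ : α < β) (ξ : ℝ)
    (i : ℕ) (k : ℤ) : iteratedDeriv i (periodicExtension F α β) (ξ + k * (β - α))
      = iteratedDeriv i (periodicExtension F α β) ξ := by
  have h := congrFun (iteratedDeriv_comp_add_const i (periodicExtension F α β) (k * (β - α))) ξ
  simp only [periodicExtension_add_int_mul hαβ] at h
  exact h.symm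

theorem mem_realsWithoutTranslates {τ T ξ : ℝ} (k : ℤ)
    (h : ξ ∈ Ioo (τ + k * T) (τ + (k + 1) * T)) : ξ ∈ realsWithoutTranslates τ T := by
  have hT : 0 < T := by linarith [h.1, h.2]
  rintro l rfl
  have h1 : (k : ℝ) < l := by
    by_contra! hle
    nlinarith [h.1]
  have h2 : (l : ℝ) < k + 1 := by
    by_contra! hle
    nlinarith [h.2]
  have h1' : k < l := by exact_mod_cast h1
  have h2' : l < k + 1 := by exact_mod_cast h2
  omega

theorem eqOn_iteratedDeriv_periodicExtension (F : ℝ → ℝ) (α β : ℝ) (i : ℕ) :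
    EqOn (iteratedDeriv i (periodicExtension F α β)) (iteratedDeriv i F) (Ioo α β) :=
  EqOn.iteratedDeriv_of_isOpen (fun _ hx => periodicExtension_eq (Ioo_subset_Ico_self hx))
    isOpen_Ioo i

/-- A closed interval avoiding the translates of `τ` lies strictly between two consecutive ones.
After a shift by a period it can meet only the seam `β ≡ α`, so integrability near the two ends,
with smoothness elsewhere, is enough. The value at the seam has no effect on integrals. -/
theorem isPeriodizedToOrder_iff {F : ℝ → ℝ} {α β τ : ℝ} {q : ℕ} (hτ : τ ∈ Ioo α β)
    (hFl : ContDiffOn ℝ ∞ F (Ioo α τ)) (hFr : ContDiffOn ℝ ∞ F (Ioo τ β)) :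
    IsPeriodizedToOrder (periodicExtension F α β) α β τ q ↔
      VanishesAlong F (𝓝[>] α) q ∧ VanishesAlong F (𝓝[<] β) q := by
  have hαβ : α < β := hτ.1.trans hτ.2
  have heq := eqOn_iteratedDeriv_periodicExtension F α β
  have hnl : Ioo α β ∈ 𝓝[>] α := Ioo_mem_nhdsGT hαβ
  have hnr : Ioo α β ∈ 𝓝[<] β := Ioo_mem_nhdsLT hαβ
  constructor
  · intro h
    refine ⟨⟨fun i hi => (h.left i hi).congr' ?_, ?_⟩, ⟨fun i hi => (h.right i hi).congr' ?_, ?_⟩⟩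
    · filter_upwards [hnl] with x hx using heq i hx
    · obtain ⟨d, hd⟩ := nonempty_Ioo.2 hτ.1
      refine ⟨Ioo α d, Ioo_mem_nhdsGT hd.1, ?_⟩
      have h1 := h.integrable α d fun x hx => mem_realsWithoutTranslates (-1)
        ⟨by push_cast; linarith [hx.1, hτ.2], by push_cast; linarith [hx.2, hd.2]⟩
      refine (h1.mono_set Ioo_subset_Icc_self).congr_fun (fun x hx => heq q ?_) measurableSet_Ioo
      exact ⟨hx.1, hx.2.trans (hd.2.trans hτ.2)⟩
    · filter_upwards [hnr] with x hx using heq i hx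
    · obtain ⟨d, hd⟩ := nonempty_Ioo.2 hτ.2
      refine ⟨Ioo d β, Ioo_mem_nhdsLT hd.2, ?_⟩
      have h1 := h.integrable d β fun x hx => mem_realsWithoutTranslates 0
        ⟨by push_cast; linarith [hx.1, hd.1], by push_cast; linarith [hx.2, hτ.1]⟩
      refine (h1.mono_set Ioo_subset_Icc_self).congr_fun (fun x hx => heq q ?_) measurableSet_Ioo
      exact ⟨hτ.1.trans (hd.1.trans hx.1), hx.2⟩
  · rintro ⟨hl, hr⟩
    refine ⟨fun i hi => (hl.tendsto i hi).congr' ?_, fun i hi => (hr.tendsto i hi).congr' ?_, ?_⟩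
    · filter_upwards [hnl] with x hx using (heq i hx).symm
    · filter_upwards [hnr] with x hx using (heq i hx).symm
    · intro c d hcd
      rcases lt_or_ge d c with hlt | hle
      · rw [Icc_eq_empty (not_le.2 hlt)]; exact integrableOn_empty
      set Φq := iteratedDeriv q (periodicExtension F α β) with hΦq
      have hΦl : ∀ x ∈ Ioo α τ, IntervalIntegrable Φq volume α x := by
        intro x hx
        have := hl.intervalIntegrable_left hFl hx
        rw [intervalIntegrable_iff_integrableOn_Ioo_of_le hx.1.le] at this ⊢
        exact this.congr_fun (fun y hy => (heq q ⟨hy.1, hy.2.trans (hx.2.trans hτ.2)⟩).symm)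
          measurableSet_Ioo
      have hΦr : ∀ x ∈ Ioo τ β, IntervalIntegrable Φq volume x β := by
        intro x hx
        have := hr.intervalIntegrable_right hFr hx
        rw [intervalIntegrable_iff_integrableOn_Ioo_of_le hx.2.le] at this ⊢
        exact this.congr_fun (fun y hy => (heq q ⟨hτ.1.trans (hx.1.trans hy.1), hy.2⟩).symm)
          measurableSet_Ioo
      have hshift : ∀ (k : ℤ) (x y : ℝ), IntervalIntegrable Φq volume x y →
          IntervalIntegrable Φq volume (x + k * (β - α)) (y + k * (β - α)) := by
        intro k x y hxy
        refine (hxy.comp_sub_right (k * (β - α))).congr fun z _ => ?_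
        have := iteratedDeriv_periodicExtension_add_int_mul (F := F) hαβ (z - k * (β - α)) q k
        rw [sub_add_cancel] at this
        exact this.symm
      -- The seam `β` is the base point: to its left the interval lies in `(τ, β]`, to its right it
      -- is a translate of an interval in `[α, τ)`.
      have hmain : ∀ x ∈ Ioo τ (τ + (β - α)), IntervalIntegrable Φq volume x β := by
        intro x hx
        rcases lt_trichotomy x β with hlt | rfl | hgt
        · exact hΦr x ⟨hx.1, hlt⟩
        · exact IntervalIntegrable.refl
        · have := hshift 1 α (x - (β - α)) (hΦl _ ⟨by linarith, by linarith [hx.2]⟩)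
          rw [Int.cast_one, one_mul, sub_add_cancel, add_sub_cancel] at this
          exact this.symm
      have hT : 0 < β - α := sub_pos.2 hαβ
      set k : ℤ := ⌊(c - τ) / (β - α)⌋ with hk
      have hk1 : (k : ℝ) * (β - α) ≤ c - τ := by
        rw [← le_div_iff₀ hT]; exact Int.floor_le _
      have hk2 : c - τ < (k + 1) * (β - α) := by
        rw [← div_lt_iff₀ hT]; exact Int.lt_floor_add_one _
      have hkc : τ + k * (β - α) ≠ c := fun h =>
        hcd (left_mem_Icc.2 hle) k h.symm
      have hkd : d < τ + (k + 1) * (β - α) := by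
        by_contra! hge
        refine hcd (a := τ + (k + 1) * (β - α)) ⟨by linarith, hge⟩ (k + 1) ?_
        push_cast
        ring
      have hkc' : τ + k * (β - α) < c := lt_of_le_of_ne (by linarith) hkc
      have hcd' := hshift k _ _ ((hmain (c - k * (β - α)) ⟨by linarith, by linarith⟩).trans
        (hmain (d - k * (β - α)) ⟨by linarith, by linarith⟩).symm)
      rw [sub_add_cancel, sub_add_cancel, intervalIntegrable_iff_integrableOn_Icc_of_le hle] at hcd'
      exact hcd'

theorem IsVariableTransformation.ne {ψ : ℝ → ℝ} {α β a b ξ τ : ℝ}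
    (hψ : IsVariableTransformation ψ α β a b) (hξ : ξ ∈ Icc α β) (hτ : τ ∈ Icc α β) (h : ξ ≠ τ) :
    ψ ξ - ψ τ ≠ 0 :=
  sub_ne_zero.2 fun he => h (hψ.strictMonoOn.injOn hξ hτ he)

theorem contDiffOn_transformed {g ψ : ℝ → ℝ} {α β a b τ : ℝ} (m : ℕ)
    (hψ : IsVariableTransformation ψ α β a b) (hg : ContDiffOn ℝ ∞ g (Ioo a b))
    (hτ : τ ∈ Ioo α β) {U : Set ℝ} (hU : U ⊆ Ioo α β) (hτU : τ ∉ U) :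
    ContDiffOn ℝ ∞ (transformed (integrand g (ψ τ) m) ψ α β) U := by
  have hψU := hψ.contDiffOn.mono hU
  have h1 : ContDiffOn ℝ ∞ (fun ξ => g (ψ ξ) / (ψ ξ - ψ τ) ^ m * deriv ψ ξ) U := by
    refine ContDiffOn.mul (ContDiffOn.div ?_ ((hψU.sub contDiffOn_const).pow m) ?_) ?_
    · exact hg.comp hψU fun x hx => hψ.mem_Ioo (hU hx)
    · exact fun x hx => pow_ne_zero _ (hψ.ne (Ioo_subset_Icc_self (hU hx))
        (Ioo_subset_Icc_self hτ) fun h => hτU (h ▸ hx))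
    · exact (hψ.contDiffOn.deriv_of_isOpen isOpen_Ioo (m := ∞) (by simp)).mono hU
  exact h1.congr fun x hx => by rw [transformed, indicator_of_mem (hU hx)]; rfl

theorem isPeriodizedToOrder_periodized_iff {g ψ : ℝ → ℝ} {α β a b τ : ℝ} {m q : ℕ}
    (hψ : IsVariableTransformation ψ α β a b) (hg : ContDiffOn ℝ ∞ g (Ioo a b))
    (hτ : τ ∈ Ioo α β) :
    IsPeriodizedToOrder (periodized g (ψ τ) m ψ α β) α β τ q ↔
      VanishesAlong (transformed (integrand g (ψ τ) m) ψ α β) (𝓝[>] α) q ∧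
      VanishesAlong (transformed (integrand g (ψ τ) m) ψ α β) (𝓝[<] β) q :=
  isPeriodizedToOrder_iff hτ
    (contDiffOn_transformed m hψ hg hτ (Ioo_subset_Ioo_right hτ.2.le) fun h => lt_irrefl _ h.2)
    (contDiffOn_transformed m hψ hg hτ (Ioo_subset_Ioo_left hτ.1.le) fun h => lt_irrefl _ h.1)

/-- The condition is local at `α` and `β`, and `ψ` maps one-sided neighbourhoods of these points
into those of `a` and `b`, where the two functions agree. -/
theorem IsPeriodizedToOrder.of_eventuallyEq {g g₁ ψ : ℝ → ℝ} {α β a b τ : ℝ} {m q : ℕ}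
    (hψ : IsVariableTransformation ψ α β a b) (hg : ContDiffOn ℝ ∞ g (Ioo a b))
    (hg₁ : ContDiffOn ℝ ∞ g₁ (Ioo a b)) (hτ : τ ∈ Ioo α β)
    (hper : IsPeriodizedToOrder (periodized g (ψ τ) m ψ α β) α β τ q)
    (ha : g₁ =ᶠ[𝓝[>] a] g) (hb : g₁ =ᶠ[𝓝[<] b] g) :
    IsPeriodizedToOrder (periodized g₁ (ψ τ) m ψ α β) α β τ q := by
  have hαβ : α < β := hτ.1.trans hτ.2
  rw [isPeriodizedToOrder_periodized_iff hψ hg hτ] at hper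
  rw [isPeriodizedToOrder_periodized_iff hψ hg₁ hτ]
  have hval : ∀ x, g₁ (ψ x) = g (ψ x) → transformed (integrand g (ψ τ) m) ψ α β x
      = transformed (integrand g₁ (ψ τ) m) ψ α β x := by
    intro x hx
    by_cases hI : x ∈ Ioo α β
    · simp only [transformed, indicator_of_mem hI, integrand, hx]
    · simp only [transformed, indicator_of_notMem hI]
  have htl : Tendsto ψ (𝓝[>] α) (𝓝[>] a) := by
    refine tendsto_nhdsWithin_iff.2 ⟨?_, ?_⟩
    · have := (hψ.continuousOn α (left_mem_Icc.2 hαβ.le)).tendsto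
      rw [hψ.map_left] at this
      exact this.mono_left (nhdsWithin_le_of_mem (mem_of_superset (Ioo_mem_nhdsGT hαβ)
        Ioo_subset_Icc_self))
    · filter_upwards [Ioo_mem_nhdsGT hαβ] with x hx using (hψ.mem_Ioo hx).1
  have htr : Tendsto ψ (𝓝[<] β) (𝓝[<] b) := by
    refine tendsto_nhdsWithin_iff.2 ⟨?_, ?_⟩
    · have := (hψ.continuousOn β (right_mem_Icc.2 hαβ.le)).tendsto
      rw [hψ.map_right] at this
      exact this.mono_left (nhdsWithin_le_of_mem (mem_of_superset (Ioo_mem_nhdsLT hαβ)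
        Ioo_subset_Icc_self))
    · filter_upwards [Ioo_mem_nhdsLT hαβ] with x hx using (hψ.mem_Ioo hx).2
  obtain ⟨d, hd, hdl⟩ := (mem_nhdsGT_iff_exists_Ioo_subset' hαβ).1 (htl ha)
  obtain ⟨c, hc, hcr⟩ := (mem_nhdsLT_iff_exists_Ioo_subset' hαβ).1 (htr hb)
  exact ⟨hper.1.congr isOpen_Ioo (Ioo_mem_nhdsGT hd) fun x hx => hval x (hdl hx),
    hper.2.congr isOpen_Ioo (Ioo_mem_nhdsLT hc) fun x hx => hval x (hcr hx)⟩

/-- Changing the order and the position of the pole multiplies the transformed integrand, near an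
end point, by a function with bounded derivatives. -/
theorem VanishesAlong.change_pole {g ψ : ℝ → ℝ} {α β a b τ τ₁ c d : ℝ} {m m₁ q : ℕ} {l : Filter ℝ}
    [l.IsMeasurablyGenerated]
    (hψ : IsVariableTransformation ψ α β a b) (hg : ContDiffOn ℝ ∞ g (Ioo a b))
    (hτ : τ ∈ Ioo α β) (hτ₁ : τ₁ ∈ Ioo α β) (hψq : ContDiffOn ℝ q ψ (Icc α β))
    (h : VanishesAlong (transformed (integrand g (ψ τ) m) ψ α β) l q) (hcd : c < d)
    (hsub : Icc c d ⊆ Icc α β) (hτcd : τ ∉ Icc c d) (hτ₁cd : τ₁ ∉ Icc c d) (hl : Ioo c d ∈ l) :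
    VanishesAlong (transformed (integrand g (ψ τ₁) m₁) ψ α β) l q := by
  have hIoo : Ioo c d ⊆ Ioo α β :=
    Ioo_subset_Ioo (hsub (left_mem_Icc.2 hcd.le)).1 (hsub (right_mem_Icc.2 hcd.le)).2
  have hne : ∀ x ∈ Icc c d, ψ x - ψ τ ≠ 0 := fun x hx =>
    hψ.ne (hsub hx) (Ioo_subset_Icc_self hτ) fun h => hτcd (h ▸ hx)
  have hne₁ : ∀ x ∈ Icc c d, ψ x - ψ τ₁ ≠ 0 := fun x hx =>
    hψ.ne (hsub hx) (Ioo_subset_Icc_self hτ₁) fun h => hτ₁cd (h ▸ hx)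
  -- The factor that turns the old transformed integrand into the new one; neither pole lies in `[c,
  -- d]`.
  set w : ℝ → ℝ := fun x => (ψ x - ψ τ) ^ m / (ψ x - ψ τ₁) ^ m₁ with hw
  have hwI : ContDiffOn ℝ ∞ w (Ioo c d) :=
    (((hψ.contDiffOn.mono hIoo).sub contDiffOn_const).pow m).div
      (((hψ.contDiffOn.mono hIoo).sub contDiffOn_const).pow m₁)
      fun x hx => pow_ne_zero _ (hne₁ x (Ioo_subset_Icc_self hx))
  have hwq : ContDiffOn ℝ q w (Icc c d) :=
    (((hψq.mono hsub).sub contDiffOn_const).pow m).div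
      (((hψq.mono hsub).sub contDiffOn_const).pow m₁) fun x hx => pow_ne_zero _ (hne₁ x hx)
  have hfin : (volume : Measure ℝ).FiniteAtFilter l := ⟨Ioo c d, hl, measure_Ioo_lt_top⟩
  have hmul := h.mul (w := w) hfin isOpen_Ioo hl
    (contDiffOn_transformed m hψ hg hτ hIoo fun h => hτcd (Ioo_subset_Icc_self h)) hwI ?_
  · refine hmul.congr isOpen_Ioo hl fun x hx => ?_
    have h1 := hne x (Ioo_subset_Icc_self hx)
    have h2 := hne₁ x (Ioo_subset_Icc_self hx)
    simp only [Pi.mul_apply, transformed, indicator_of_mem (hIoo hx), integrand, hw]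
    field_simp
  -- The factor is `C^q` on the compact interval, endpoint included, so its derivatives up to order
  -- `q` are bounded. Here the smoothness of `ψ` up to the boundary enters.
  · intro i hi
    obtain ⟨M, hM⟩ := isCompact_Icc.exists_bound_of_continuousOn
      (hwq.continuousOn_iteratedDerivWithin (m := i) (by exact_mod_cast hi)
        (uniqueDiffOn_Icc hcd))
    refine ⟨M, fun x hx => ?_⟩
    rw [← iteratedDerivWithin_eq_iteratedDeriv (uniqueDiffOn_Icc hcd)
      ((hwI.contDiffAt (isOpen_Ioo.mem_nhds hx)).of_le (by exact_mod_cast le_top))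
      (Ioo_subset_Icc_self hx)]
    exact hM x (Ioo_subset_Icc_self hx)

theorem IsPeriodizedToOrder.change_pole {g ψ : ℝ → ℝ} {α β a b τ τ₁ : ℝ} {m m₁ q : ℕ}
    (hψ : IsVariableTransformation ψ α β a b) (hg : ContDiffOn ℝ ∞ g (Ioo a b))
    (hτ : τ ∈ Ioo α β) (hτ₁ : τ₁ ∈ Ioo α β) (hψq : ContDiffOn ℝ q ψ (Icc α β))
    (hper : IsPeriodizedToOrder (periodized g (ψ τ) m ψ α β) α β τ q) :
    IsPeriodizedToOrder (periodized g (ψ τ₁) m₁ ψ α β) α β τ₁ q := by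
  rw [isPeriodizedToOrder_periodized_iff hψ hg hτ] at hper
  rw [isPeriodizedToOrder_periodized_iff hψ hg hτ₁]
  obtain ⟨d, hd⟩ := nonempty_Ioo.2 (lt_min hτ.1 hτ₁.1)
  obtain ⟨c, hc⟩ := nonempty_Ioo.2 (max_lt hτ.2 hτ₁.2)
  have hdτ := hd.2.trans_le (min_le_left _ _)
  have hdτ₁ := hd.2.trans_le (min_le_right _ _)
  have hcτ := (le_max_left _ _).trans_lt hc.1
  have hcτ₁ := (le_max_right _ _).trans_lt hc.1
  exact ⟨hper.1.change_pole hψ hg hτ hτ₁ hψq hd.1 (Icc_subset_Icc_right (by linarith [hτ.2]))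
      (fun h => by linarith [h.2]) (fun h => by linarith [h.2]) (Ioo_mem_nhdsGT hd.1),
    hper.2.change_pole hψ hg hτ hτ₁ hψq hc.2 (Icc_subset_Icc_left (by linarith [hτ.1]))
      (fun h => by linarith [h.1]) (fun h => by linarith [h.1]) (Ioo_mem_nhdsLT hc.2)⟩

/-! ### Periodic functions with a prescribed principal part -/

/-- The `T`-periodic function with principal part `∑ γ k / (ξ - τ) ^ (m - k)` at `τ`. -/
noncomputable def poleSum (γ : ℕ → ℝ) (m : ℕ) (τ T ξ : ℝ) : ℝ :=
  ∑ k ∈ Finset.range m, γ k * (T ^ (m - k))⁻¹ * periodicPole (m - k) ((ξ - τ) / T)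

/-- The regular part of `poleSum` at `τ`. -/
noncomputable def poleSumTail (γ : ℕ → ℝ) (m : ℕ) (τ T ξ : ℝ) : ℝ :=
  ∑ k ∈ Finset.range m, γ k * (T ^ (m - k))⁻¹ * poleTail (m - k) ((ξ - τ) / T)

/-- A primitive of `poleSum`. -/
noncomputable def poleSumPrimitive (γ : ℕ → ℝ) (m : ℕ) (τ T ξ : ℝ) : ℝ :=
  ∑ k ∈ Finset.range m, γ k * (T ^ (m - k))⁻¹ * T * periodicPolePrimitive (m - k - 1) ((ξ - τ) / T)

section poleSum

variable (γ : ℕ → ℝ) (m : ℕ) (τ : ℝ) {T : ℝ}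

theorem add_period_sub_div (hT : 0 < T) (ξ : ℝ) : (ξ + T - τ) / T = (ξ - τ) / T + 1 := by
  have := hT.ne'
  field_simp
  ring

theorem poleSum_add_period (hT : 0 < T) (ξ : ℝ) :
    poleSum γ m τ T (ξ + T) = poleSum γ m τ T ξ := by
  simp only [poleSum, add_period_sub_div τ hT, periodicPole_add_one]

theorem poleSumPrimitive_add_period (hT : 0 < T) (ξ : ℝ) :
    poleSumPrimitive γ m τ T (ξ + T) = poleSumPrimitive γ m τ T ξ := by
  simp only [poleSumPrimitive, add_period_sub_div τ hT, periodicPolePrimitive_add_one]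

theorem sub_div_mem_Ioo (hT : 0 < T) {ξ : ℝ} (hξ : ξ ∈ Ioo (τ - T) (τ + T)) :
    (ξ - τ) / T ∈ Ioo (-1 : ℝ) 1 :=
  ⟨by rw [lt_div_iff₀ hT]; linarith [hξ.1], by rw [div_lt_one hT]; linarith [hξ.2]⟩

theorem poleSum_eq (hT : 0 < T) {ξ : ℝ} (hξ : ξ ∈ Ioo (τ - T) (τ + T)) :
    poleSum γ m τ T ξ = ∑ k ∈ Finset.range m, γ k * ((ξ - τ) ^ (m - k))⁻¹
      + poleSumTail γ m τ T ξ := by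
  rw [poleSum, poleSumTail, ← Finset.sum_add_distrib]
  refine Finset.sum_congr rfl fun k hk => ?_
  obtain ⟨p, hp⟩ : ∃ p, m - k = p + 1 := ⟨m - k - 1, by have := Finset.mem_range.1 hk; omega⟩
  rw [hp, periodicPole_eq p (sub_div_mem_Ioo τ hT hξ), div_pow, inv_div]
  have := hT.ne'
  field_simp

theorem contDiffOn_poleSumTail (hT : 0 < T) :
    ContDiffOn ℝ ∞ (poleSumTail γ m τ T) (Ioo (τ - T) (τ + T)) := by
  refine ContDiffOn.sum fun k hk => contDiffOn_const.mul ?_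
  obtain ⟨p, hp⟩ : ∃ p, m - k = p + 1 := ⟨m - k - 1, by have := Finset.mem_range.1 hk; omega⟩
  rw [hp]
  exact (contDiffOn_poleTail p).comp (by fun_prop) fun ξ hξ => sub_div_mem_Ioo τ hT hξ

theorem contDiffAt_poleSum (hT : 0 < T) {ξ : ℝ} (hξ : ξ ∈ Ioo (τ - T) (τ + T)) (hne : ξ ≠ τ) :
    ContDiffAt ℝ ∞ (poleSum γ m τ T) ξ := by
  have hnhds := isOpen_Ioo.mem_nhds hξ
  have h1 : ContDiffAt ℝ ∞ (fun ξ : ℝ => ∑ k ∈ Finset.range m, γ k * ((ξ - τ) ^ (m - k))⁻¹) ξ := by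
    refine ContDiffAt.sum fun k _ => contDiffAt_const.mul ?_
    exact ((contDiffAt_id.sub contDiffAt_const).pow _).inv (pow_ne_zero _ (sub_ne_zero.2 hne))
  refine (h1.add ((contDiffOn_poleSumTail γ m τ hT).contDiffAt hnhds)).congr_of_eventuallyEq ?_
  filter_upwards [hnhds] with x hx using poleSum_eq γ m τ hT hx

theorem hasDerivAt_poleSumPrimitive (hT : 0 < T) {ξ : ℝ} (hξ : ξ ∈ Ioo (τ - T) (τ + T))
    (hne : ξ ≠ τ) : HasDerivAt (poleSumPrimitive γ m τ T) (poleSum γ m τ T ξ) ξ := by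
  refine HasDerivAt.fun_sum fun k hk => ?_
  obtain ⟨p, hp⟩ : ∃ p, m - k = p + 1 := ⟨m - k - 1, by have := Finset.mem_range.1 hk; omega⟩
  rw [hp, Nat.add_sub_cancel]
  have h1 : HasDerivAt (fun ξ : ℝ => (ξ - τ) / T) (1 / T) ξ :=
    ((hasDerivAt_id ξ).sub_const τ).div_const T
  have h2 := ((hasDerivAt_periodicPolePrimitive p (sub_div_mem_Ioo τ hT hξ)
    (div_ne_zero (sub_ne_zero.2 hne) hT.ne')).comp ξ h1).const_mul (γ k * (T ^ (p + 1))⁻¹ * T)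
  refine h2.congr_deriv ?_
  have := hT.ne'
  field_simp

theorem hasFinitePart_poleSumPrimitive (hT : 0 < T) :
    HasFinitePart (fun ε => poleSumPrimitive γ m τ T (τ - ε) - poleSumPrimitive γ m τ T (τ + ε))
      0 := by
  have h := HasFinitePart.sum (Finset.range m) (I := fun _ => 0) fun k _ => by
    simpa only [mul_zero] using (hasFinitePart_periodicPolePrimitive (m - k - 1) hT).const_mul
      (γ k * (T ^ (m - k))⁻¹ * T)
  rw [Finset.sum_const_zero] at h
  refine h.congr' (Eventually.of_forall fun ε => ?_)
  simp only [poleSumPrimitive, ← Finset.sum_sub_distrib]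
  refine Finset.sum_congr rfl fun k _ => ?_
  have e1 : τ - ε - τ = -ε := by ring
  rw [e1, add_sub_cancel_left, mul_sub]

theorem sum_poleSum (hT : 0 < T) {n : ℕ} (hn : 1 ≤ n) :
    ∑ j ∈ Finset.range n, poleSum γ m τ T (τ + j * (T / n))
      = ∑ k ∈ Finset.range m, γ k * ((T / n) ^ (m - k))⁻¹ * periodicPole (m - k) 0 := by
  simp only [poleSum]
  rw [Finset.sum_comm]
  refine Finset.sum_congr rfl fun k hk => ?_
  have hk' := Finset.mem_range.1 hk
  have hT' := hT.ne'
  have hn' : (n : ℝ) ≠ 0 := by positivity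
  have : ∀ j : ℕ, (τ + j * (T / n) - τ) / T = j / n := fun j => by field_simp; ring
  simp only [this]
  rw [← Finset.mul_sum, sum_periodicPole (by omega) hn, div_pow, inv_div]
  field_simp

end poleSum

/-! ### The corrections as exact node sums -/

/-- With `m = 2r + e`, an index `k` such that `k + e` is odd belongs to a pole of odd order `m - k`,
whose node sum vanishes. One formula thus treats even and odd `m`. -/
theorem sum_range_of_parity (e : ℕ) (he : e < 2) (a : ℕ → ℝ) (r : ℕ)
    (ha : ∀ k < 2 * r + e, Odd (k + e) → a k = 0) :
    ∑ k ∈ Finset.range (2 * r + e), a k = ∑ i ∈ Finset.range r, a (2 * i + e) := by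
  induction r with
  | zero =>
    interval_cases e
    · simp
    · simpa using ha 0 (by omega) (by decide)
  | succ r ih =>
    have h1 : 2 * (r + 1) + e = 2 * r + e + 1 + 1 := by ring
    rw [h1, Finset.sum_range_succ, Finset.sum_range_succ, Finset.sum_range_succ,
      ih fun k hk => ha k (by omega), ha (2 * r + e + 1) (by omega) ⟨r + e, by ring⟩, add_zero]

/-- Identifies the zeta terms with the node sums of the periodic poles, so that the rule becomes an
ordinary trapezoidal sum for the function without its poles. -/
theorem correctedTrapezoidal_eq (Φ G : ℝ → ℝ) (τ : ℝ) {T : ℝ} (hT : 0 < T) (m : ℕ) {n : ℕ}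
    (hn : 1 ≤ n) :
    correctedTrapezoidal Φ G τ T m n = T / n * (∑ j ∈ Finset.Icc 1 (n - 1), Φ (τ + j * (T / n))
      + iteratedDeriv m G τ / (m.factorial : ℝ)
      - ∑ j ∈ Finset.range n,
        poleSum (fun k => iteratedDeriv k G τ / (k.factorial : ℝ)) m τ T (τ + j * (T / n))) := by
  set γ : ℕ → ℝ := fun k => iteratedDeriv k G τ / (k.factorial : ℝ) with hγ
  have hh : T / n ≠ 0 := div_ne_zero hT.ne' (by positivity)
  obtain ⟨r, e, he, hm⟩ : ∃ r e, e < 2 ∧ m = 2 * r + e :=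
    ⟨m / 2, m % 2, Nat.mod_lt _ (by omega), by omega⟩
  have hr : m / 2 = r := by omega
  have he' : m % 2 = e := by omega
  rw [sum_poleSum γ m τ hT hn, correctedTrapezoidal]
  simp only [hr, he']
  set h := T / (n : ℝ)
  have hpar : ∑ k ∈ Finset.range m, γ k * (h ^ (m - k))⁻¹ * periodicPole (m - k) 0
      = ∑ i ∈ Finset.range r, γ (2 * i + e) * (h ^ (2 * r - 2 * i))⁻¹
        * (2 * (riemannZeta (2 * (r : ℂ) - 2 * (i : ℂ))).re) := by
    conv_lhs => rw [hm]
    rw [sum_range_of_parity e he]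
    · refine Finset.sum_congr rfl fun i hi => ?_
      have hi' := Finset.mem_range.1 hi
      have h1 : 2 * r + e - (2 * i + e) = 2 * r - 2 * i := by omega
      rw [h1, periodicPole_zero_of_even ⟨r - i, by omega⟩ (by omega), Nat.cast_sub (by omega)]
      push_cast
      rfl
    · intro k hk hodd
      rw [periodicPole_zero_of_odd, mul_zero]
      rw [Nat.odd_iff] at hodd ⊢
      omega
  -- The summand `i = r` carries `ζ(0) = -1/2` and `h^1`. Times `-2` it is `h G^{(m)}(τ)/m!`, the
  -- contribution of the node `τ`.
  rw [hpar, Finset.sum_range_succ, sub_self, riemannZeta_zero, ← hm]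
  have h1 : ∀ i ∈ Finset.range r, iteratedDeriv (2 * i + e) G τ / ((2 * i + e).factorial : ℝ)
        * (riemannZeta (2 * (r : ℂ) - 2 * (i : ℂ))).re * h ^ (-2 * (r : ℤ) + 2 * (i : ℤ) + 1)
      = h / 2 * (γ (2 * i + e) * (h ^ (2 * r - 2 * i))⁻¹
        * (2 * (riemannZeta (2 * (r : ℂ) - 2 * (i : ℂ))).re)) := by
    intro i hi
    have hi' := Finset.mem_range.1 hi
    have e1 : h ^ (-2 * (r : ℤ) + 2 * (i : ℤ) + 1) = (h ^ (2 * r - 2 * i))⁻¹ * h := by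
      rw [zpow_add_one₀ hh, ← zpow_natCast, ← zpow_neg, Nat.cast_sub (by omega)]
      congr 2
      push_cast
      ring
    rw [e1]
    simp only [hγ]
    ring
  rw [Finset.sum_congr rfl h1, ← Finset.mul_sum]
  have h2 : -2 * (r : ℤ) + 2 * (r : ℤ) + 1 = 1 := by ring
  have h3 : ((-1 / 2 : ℂ)).re = -1 / 2 := by norm_num
  rw [h2, h3, zpow_one]
  ring

/-! ### Convergence of the trapezoidal rule after subtraction of the poles -/

/-- The trapezoidal rule started at an interior point `τ` of `[α, β]`, for a function on `[α, β]`
that is continued periodically. -/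
theorem exists_trapezoidal_error_le_of_interior {u : ℕ → ℝ → ℝ} {α β τ : ℝ} {q : ℕ}
    (hτ : τ ∈ Ioo α β) (hq : 1 ≤ q) (hc : ∀ k < q, ContinuousOn (u k) (Icc α β))
    (hd : ∀ k < q, ∀ x ∈ Ioo α β, HasDerivAt (u k) (u (k + 1) x) x)
    (hper : ∀ k < q, u k β = u k α) (hi : IntervalIntegrable (u q) volume α β) :
    ∃ C : ℝ, ∀ n : ℕ, 1 ≤ n →
      |(β - α) / n * ∑ j ∈ Finset.range n, (fun x => if x ≤ β then u 0 x else u 0 (x - (β - α)))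
          (τ + j * ((β - α) / n)) - ∫ x in α..β, u 0 x| ≤ C * ((β - α) / n) ^ q := by
  have hαβ : α < β := hτ.1.trans hτ.2
  set T := β - α with hT
  have hTpos : 0 < T := sub_pos.2 hαβ
  set S : ℕ → ℝ → ℝ := fun k x => if x ≤ β then u k x else u k (x - T) with hS
  have hSl : ∀ k x, x ≤ β → S k x = u k x := fun k x hx => if_pos hx
  have hSr : ∀ k x, β < x → S k x = u k (x - T) := fun k x hx => if_neg (not_le.2 hx)
  have hcS : ∀ k < q, ContinuousOn (S k) (Icc τ (τ + T)) := by
    intro k hk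
    -- A continuous extension to the whole line, so that the two pieces can be glued at `β`, where
    -- they match by `hper`.
    set v : ℝ → ℝ := IccExtend hαβ.le ((Icc α β).domRestrict (u k)) with hv
    have hvc : Continuous v := (continuousOn_iff_continuous_domRestrict.1 (hc k hk)).Icc_extend'
    have hvu : ∀ x ∈ Icc α β, v x = u k x := fun x hx => by
      rw [hv, IccExtend_of_mem _ _ hx]; rfl
    have h1 : Continuous fun x => if x ≤ β then v x else v (x - T) := by
      refine Continuous.if_le hvc (hvc.comp (by fun_prop)) continuous_id continuous_const ?_
      rintro x rfl
      have e1 : x - T = α := by rw [hT]; ring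
      rw [e1, hvu x (right_mem_Icc.2 hαβ.le), hvu α (left_mem_Icc.2 hαβ.le), hper k hk]
    refine h1.continuousOn.congr fun x hx => ?_
    change S k x = if x ≤ β then v x else v (x - T)
    by_cases hxβ : x ≤ β
    · rw [hSl k x hxβ, if_pos hxβ, hvu x ⟨by linarith [hx.1, hτ.1], hxβ⟩]
    · rw [hSr k x (not_le.1 hxβ), if_neg hxβ,
        hvu (x - T) ⟨by linarith [not_le.1 hxβ], by linarith [hx.2, hτ.2]⟩]
  have hdS : ∀ k < q, ∀ x ∈ Ioo τ (τ + T) \ {β}, HasDerivAt (S k) (S (k + 1) x) x := by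
    rintro k hk x ⟨hx, hxβ⟩
    rcases lt_or_gt_of_ne (show x ≠ β from hxβ) with hlt | hgt
    · rw [hSl _ _ hlt.le]
      refine (hd k hk x ⟨hτ.1.trans hx.1, hlt⟩).congr_of_eventuallyEq ?_
      filter_upwards [isOpen_Iio.mem_nhds hlt] with y hy using hSl k y (le_of_lt hy)
    · rw [hSr _ _ hgt]
      have h1 := (hd k hk (x - T) ⟨by linarith, by linarith [hx.2, hτ.2]⟩).comp x
        ((hasDerivAt_id x).sub_const T)
      rw [mul_one] at h1
      refine h1.congr_of_eventuallyEq ?_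
      filter_upwards [isOpen_Ioi.mem_nhds hgt] with y hy using hSr k y hy
  have hsplit : ∀ k, IntervalIntegrable (u k) volume α β →
      IntervalIntegrable (S k) volume τ β ∧ IntervalIntegrable (S k) volume β (τ + T) ∧
      ∫ x in τ..(τ + T), S k x = ∫ x in α..β, u k x := by
    intro k hk
    have hατ : IntervalIntegrable (u k) volume α τ := hk.mono_set (by
      rw [uIcc_of_le hτ.1.le, uIcc_of_le hαβ.le]; exact Icc_subset_Icc_right hτ.2.le)
    have hτβ : IntervalIntegrable (u k) volume τ β := hk.mono_set (by
      rw [uIcc_of_le hτ.2.le, uIcc_of_le hαβ.le]; exact Icc_subset_Icc_left hτ.1.le)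
    have hsh := hατ.comp_sub_right T
    have e1 : α + T = β := by rw [hT]; ring
    rw [e1] at hsh
    have hβτ : β ≤ τ + T := by linarith [hτ.1]
    have h1 : IntervalIntegrable (S k) volume τ β := by
      refine hτβ.congr fun x hx => ?_
      rw [uIoc_of_le hτ.2.le] at hx
      exact (hSl k x hx.2).symm
    have h2 : IntervalIntegrable (S k) volume β (τ + T) := by
      refine hsh.congr fun x hx => ?_
      rw [uIoc_of_le hβτ] at hx
      exact (hSr k x hx.1).symm
    refine ⟨h1, h2, ?_⟩
    have i1 : ∫ x in τ..β, S k x = ∫ x in τ..β, u k x :=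
      intervalIntegral.integral_congr fun x hx => hSl k x (by
        rw [uIcc_of_le hτ.2.le] at hx; exact hx.2)
    have i2 : ∫ x in β..(τ + T), S k x = ∫ x in α..τ, u k x := by
      have : ∫ x in β..(τ + T), S k x = ∫ x in β..(τ + T), u k (x - T) := by
        refine intervalIntegral.integral_congr_ae (Eventually.of_forall fun x hx => ?_)
        rw [uIoc_of_le hβτ] at hx
        exact hSr k x hx.1
      rw [this, intervalIntegral.integral_comp_sub_right, add_sub_cancel_right]
      congr 1
      linarith
    rw [← intervalIntegral.integral_add_adjacent_intervals h1 h2, i1, i2, add_comm,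
      intervalIntegral.integral_add_adjacent_intervals hατ hτβ]
  have hperS : ∀ k < q, S k (τ + T) = S k τ := by
    intro k _
    rw [hSl k τ hτ.2.le, hSr k (τ + T) (by linarith [hτ.1]), add_sub_cancel_right]
  -- The seam `β` is the exceptional point: the derivative of order `q` need not exist there.
  obtain ⟨C, hC⟩ := exists_trapezoidal_error_le (S := S) (countable_singleton β) hTpos hq hcS hdS
    hperS ((hsplit q hi).1.trans (hsplit q hi).2.1)
  refine ⟨C, fun n hn => ?_⟩
  have h0 : IntervalIntegrable (u 0) volume α β := by
    refine ContinuousOn.intervalIntegrable ?_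
    rw [uIcc_of_le hαβ.le]
    exact hc 0 (by omega)
  have := hC n hn
  rw [(hsplit 0 h0).2.2] at this
  exact this

/-- The trapezoidal rule for a function with a pole, from which the periodic pole functions have
been subtracted, converges to the Hadamard finite part. -/
theorem exists_hadamardFinitePart_trapezoidal {F U : ℝ → ℝ} {c : ℕ → ℝ} {α β τ : ℝ} {m q : ℕ}
    (hτ : τ ∈ Ioo α β) (hq : 1 ≤ q) (hU : ContDiffOn ℝ ∞ U (Ioo α β))
    (hFU : ∀ ξ ∈ Ioo α β, ξ ≠ τ → F ξ = U ξ + poleSum c m τ (β - α) ξ) (hFα : F α = 0)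
    (hl : VanishesAlong F (𝓝[>] α) q) (hr : VanishesAlong F (𝓝[<] β) q) :
    ∃ I, HasHadamardFinitePart F α β τ I ∧
      ∃ C, ∀ n : ℕ, 1 ≤ n →
        |(β - α) / n * (∑ j ∈ Finset.Icc 1 (n - 1), periodicExtension F α β (τ + j * ((β - α) / n))
          + (U τ + poleSum c m τ (β - α) τ)
          - ∑ j ∈ Finset.range n, poleSum c m τ (β - α) (τ + j * ((β - α) / n))) - I|
        ≤ C * ((β - α) / n) ^ q := by
  have hαβ : α < β := hτ.1.trans hτ.2
  set T := β - α with hT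
  have hTpos : 0 < T := sub_pos.2 hαβ
  set W := poleSum c m τ T with hW
  have hsub : Icc α β ⊆ Ioo (τ - T) (τ + T) := fun x hx =>
    ⟨by linarith [hx.1, hτ.2], by linarith [hx.2, hτ.1]⟩
  have hWat : ∀ x ∈ Icc α β, x ≠ τ → ContDiffAt ℝ ∞ W x := fun x hx hne =>
    contDiffAt_poleSum c m τ hTpos (hsub hx) hne
  have hWcont : ∀ k, ∀ x ∈ Icc α β, x ≠ τ → ContinuousAt (iteratedDeriv k W) x := by
    intro k x hx hne
    have hopen : IsOpen (Ioo (τ - T) (τ + T) \ {τ}) := isOpen_Ioo.sdiff isClosed_singleton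
    have : ContDiffOn ℝ ∞ W (Ioo (τ - T) (τ + T) \ {τ}) := fun y hy =>
      (contDiffAt_poleSum c m τ hTpos hy.1 hy.2).contDiffWithinAt
    exact (continuousOn_iteratedDeriv hopen this k).continuousAt
      (hopen.mem_nhds ⟨hsub hx, hne⟩)
  have hWper : ∀ k, iteratedDeriv k W β = iteratedDeriv k W α := by
    intro k
    have h := congrFun (iteratedDeriv_comp_add_const k W T) α
    have h1 : (fun z => W (z + T)) = W := funext fun z => poleSum_add_period c m τ hTpos z
    rw [h1] at h
    rw [h]
    congr 1
    rw [hT]; ring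
  have hUder : ∀ k, ∀ x ∈ Ioo α β, x ≠ τ →
      iteratedDeriv k U x = iteratedDeriv k F x - iteratedDeriv k W x := by
    intro k x hx hne
    have h1 : F =ᶠ[𝓝 x] U + W := by
      filter_upwards [isOpen_Ioo.mem_nhds hx, isOpen_ne.mem_nhds hne] with y hy hyne
        using hFU y hy hyne
    rw [h1.iteratedDeriv_eq k, iteratedDeriv_add
      ((hU.contDiffAt (isOpen_Ioo.mem_nhds hx)).of_le (by exact_mod_cast le_top))
      ((hWat x (Ioo_subset_Icc_self hx) hne).of_le (by exact_mod_cast le_top))]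
    ring
  have hFI : ContDiffOn ℝ ∞ F (Ioo α β \ {τ}) := by
    refine ContDiffOn.congr (f := U + W) ?_ fun x hx => hFU x hx.1 hx.2
    exact (hU.mono sdiff_subset).add fun x hx =>
      (hWat x (Ioo_subset_Icc_self hx.1) hx.2).contDiffWithinAt
  have hFl : ContDiffOn ℝ ∞ F (Ioo α τ) := hFI.mono fun x hx => ⟨⟨hx.1, hx.2.trans hτ.2⟩, hx.2.ne⟩
  have hFr : ContDiffOn ℝ ∞ F (Ioo τ β) := hFI.mono fun x hx => ⟨⟨hτ.1.trans hx.1, hx.2⟩, hx.1.ne'⟩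
  -- As the derivatives of `F` vanish in the limit, those of `U` tend to minus those of `W`. By
  -- periodicity of `W` both ends give the same value.
  have hUl : ∀ k < q, Tendsto (iteratedDeriv k U) (𝓝[>] α) (𝓝 (-iteratedDeriv k W α)) := by
    intro k hk
    have h1 := (hl.tendsto k hk).sub ((hWcont k α (left_mem_Icc.2 hαβ.le) hτ.1.ne).tendsto.mono_left
      (nhdsWithin_le_nhds (s := Ioi α)))
    rw [zero_sub] at h1
    refine h1.congr' ?_
    filter_upwards [Ioo_mem_nhdsGT hτ.1] with x hx
      using (hUder k x ⟨hx.1, hx.2.trans hτ.2⟩ hx.2.ne).symm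
  have hUr : ∀ k < q, Tendsto (iteratedDeriv k U) (𝓝[<] β) (𝓝 (-iteratedDeriv k W α)) := by
    intro k hk
    have h1 := (hr.tendsto k hk).sub ((hWcont k β (right_mem_Icc.2 hαβ.le) hτ.2.ne').tendsto.mono_left
      (nhdsWithin_le_nhds (s := Iio β)))
    rw [zero_sub, hWper] at h1
    refine h1.congr' ?_
    filter_upwards [Ioo_mem_nhdsLT hτ.2] with x hx
      using (hUder k x ⟨hτ.1.trans hx.1, hx.2⟩ hx.1.ne').symm
  have hUc : ∀ k, ContinuousOn (iteratedDeriv k U) (Ioo α β) := continuousOn_iteratedDeriv isOpen_Ioo hU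
  set u : ℕ → ℝ → ℝ := fun k => extendFrom (Ioo α β) (iteratedDeriv k U) with hu
  have huU : ∀ k, ∀ x ∈ Ioo α β, u k x = iteratedDeriv k U x := fun k x hx =>
    extendFrom_extends (hUc k) x hx
  have hcont : ∀ k < q, ContinuousOn (u k) (Icc α β) := fun k hk =>
    continuousOn_Icc_extendFrom_Ioo (hUc k) (hUl k hk) (hUr k hk)
  have huα : ∀ k < q, u k α = -iteratedDeriv k W α := fun k hk =>
    eq_lim_at_left_extendFrom_Ioo hαβ (hUl k hk)
  have huβ : ∀ k < q, u k β = -iteratedDeriv k W α := fun k hk =>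
    eq_lim_at_right_extendFrom_Ioo hαβ (hUr k hk)
  have hder : ∀ k < q, ∀ x ∈ Ioo α β, HasDerivAt (u k) (u (k + 1) x) x := by
    intro k _ x hx
    have h1 : DifferentiableAt ℝ (iteratedDeriv k U) x := by
      have h2 := hU.differentiableOn_iteratedDerivWithin (m := k)
        (by exact_mod_cast ENat.natCast_lt_top k) isOpen_Ioo.uniqueDiffOn
      exact (h2.congr fun y hy => (iteratedDerivWithin_of_isOpen isOpen_Ioo hy).symm).differentiableAt
        (isOpen_Ioo.mem_nhds hx)
    rw [huU _ x hx, iteratedDeriv_succ]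
    refine h1.hasDerivAt.congr_of_eventuallyEq ?_
    filter_upwards [isOpen_Ioo.mem_nhds hx] with y hy using huU k y hy
  have hint : IntervalIntegrable (u q) volume α β := by
    obtain ⟨d, hd⟩ := nonempty_Ioo.2 hτ.1
    obtain ⟨e, he⟩ := nonempty_Ioo.2 hτ.2
    have h1 : IntervalIntegrable (u q) volume α d := by
      have hWi : IntervalIntegrable (iteratedDeriv q W) volume α d := by
        refine ContinuousOn.intervalIntegrable fun x hx => ?_
        rw [uIcc_of_le hd.1.le] at hx
        exact (hWcont q x ⟨hx.1, by linarith [hx.2, hd.2, hτ.2]⟩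
          (hx.2.trans_lt hd.2).ne).continuousWithinAt
      have := (hl.intervalIntegrable_left hFl hd).sub hWi
      rw [intervalIntegrable_iff_integrableOn_Ioo_of_le hd.1.le] at this ⊢
      refine this.congr_fun (fun x hx => ?_) measurableSet_Ioo
      have hx' : x ∈ Ioo α β := ⟨hx.1, hx.2.trans (hd.2.trans hτ.2)⟩
      exact ((huU q x hx').trans (hUder q x hx' (hx.2.trans hd.2).ne)).symm
    have h2 : IntervalIntegrable (u q) volume d e := by
      refine ContinuousOn.intervalIntegrable ?_
      have hIoo : uIcc d e ⊆ Ioo α β :=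
        ordConnected_Ioo.uIcc_subset ⟨hd.1, hd.2.trans hτ.2⟩ ⟨hτ.1.trans he.1, he.2⟩
      exact ((hUc q).mono hIoo).congr fun x hx => huU q x (hIoo hx)
    have h3 : IntervalIntegrable (u q) volume e β := by
      have hWi : IntervalIntegrable (iteratedDeriv q W) volume e β := by
        refine ContinuousOn.intervalIntegrable fun x hx => ?_
        rw [uIcc_of_le he.2.le] at hx
        exact (hWcont q x ⟨by linarith [hx.1, he.1, hτ.1], hx.2⟩
          (he.1.trans_le hx.1).ne').continuousWithinAt
      have := (hr.intervalIntegrable_right hFr he).sub hWi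
      rw [intervalIntegrable_iff_integrableOn_Ioo_of_le he.2.le] at this ⊢
      refine this.congr_fun (fun x hx => ?_) measurableSet_Ioo
      have hx' : x ∈ Ioo α β := ⟨hτ.1.trans (he.1.trans hx.1), hx.2⟩
      exact ((huU q x hx').trans (hUder q x hx' (he.1.trans hx.1).ne')).symm
    exact (h1.trans h2).trans h3
  have hu0 : ContinuousOn (u 0) (Icc α β) := hcont 0 hq
  have hu0i : ∀ x ∈ Icc α β, ∀ y ∈ Icc α β, IntervalIntegrable (u 0) volume x y := fun x hx y hy =>
    (hu0.mono (ordConnected_Icc.uIcc_subset hx hy)).intervalIntegrable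
  have hαm := left_mem_Icc.2 hαβ.le
  have hβm := right_mem_Icc.2 hαβ.le
  -- Away from the pole, `∫ F` is `∫ u 0` plus the increment of the primitive of `W`.
  have hFint : ∀ x y, x < y → Icc x y ⊆ Icc α β → τ ∉ Icc x y → IntervalIntegrable F volume x y ∧
      ∫ z in x..y, F z = (∫ z in x..y, u 0 z) + (poleSumPrimitive c m τ T y
        - poleSumPrimitive c m τ T x) := by
    intro x y hxy hsubxy hτxy
    have hWi : IntervalIntegrable W volume x y := by
      refine ContinuousOn.intervalIntegrable fun z hz => ?_
      rw [uIcc_of_le hxy.le] at hz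
      exact (hWat z (hsubxy hz) fun h => hτxy (h ▸ hz)).continuousAt.continuousWithinAt
    have hui := hu0i x (hsubxy (left_mem_Icc.2 hxy.le)) y (hsubxy (right_mem_Icc.2 hxy.le))
    have heq : ∀ z ∈ Ioo x y, u 0 z + W z = F z := by
      intro z hz
      have hz' : z ∈ Ioo α β := ⟨(hsubxy (left_mem_Icc.2 hxy.le)).1.trans_lt hz.1,
        hz.2.trans_le (hsubxy (right_mem_Icc.2 hxy.le)).2⟩
      rw [huU 0 z hz', iteratedDeriv_zero,
        hFU z hz' fun h => hτxy (h ▸ Ioo_subset_Icc_self hz)]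
    refine ⟨?_, ?_⟩
    · have := hui.add hWi
      rw [intervalIntegrable_iff_integrableOn_Ioo_of_le hxy.le] at this ⊢
      exact this.congr_fun heq measurableSet_Ioo
    · have h1 := intervalIntegral.integral_eq_sub_of_hasDerivAt (fun z hz =>
        hasDerivAt_poleSumPrimitive c m τ hTpos (hsub (hsubxy (uIcc_of_le hxy.le ▸ hz)))
          fun h => hτxy (h ▸ (uIcc_of_le hxy.le ▸ hz))) hWi
      rw [← h1, ← intervalIntegral.integral_add hui hWi, intervalIntegral.integral_of_le hxy.le,
        intervalIntegral.integral_of_le hxy.le, integral_Ioc_eq_integral_Ioo,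
        integral_Ioc_eq_integral_Ioo]
      exact (setIntegral_congr_fun measurableSet_Ioo heq).symm
  have hFintl : ∀ ε : ℝ, 0 < ε → ε < τ - α → _ := fun ε h1 h2 =>
    hFint α (τ - ε) (by linarith) (Icc_subset_Icc_right (by linarith [hτ.2]))
      (fun h => by linarith [h.2])
  have hFintr : ∀ ε : ℝ, 0 < ε → ε < β - τ → _ := fun ε h1 h2 =>
    hFint (τ + ε) β (by linarith) (Icc_subset_Icc_left (by linarith [hτ.1]))
      (fun h => by linarith [h.1])
  refine ⟨∫ x in α..β, u 0 x, ?_, ?_⟩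
  · refine HasFinitePart.hasHadamardFinitePart (fun ε h1 h2 => (hFintl ε h1 h2).1)
      (fun ε h1 h2 => (hFintr ε h1 h2).1) ?_
    have hprim : ContinuousAt (fun x => ∫ z in τ..x, u 0 z) τ := by
      refine (intervalIntegral.integral_hasDerivAt_right IntervalIntegrable.refl ?_ ?_).continuousAt
      · exact (hu0.mono Ioo_subset_Icc_self).stronglyMeasurableAtFilter isOpen_Ioo τ hτ
      · exact hu0.continuousAt (Icc_mem_nhds hτ.1 hτ.2)
    have hlim : ∀ r : ℝ, Tendsto (fun ε : ℝ => ∫ z in τ..(τ + r * ε), u 0 z) (𝓝[>] 0) (𝓝 0) := by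
      intro r
      have h1 : Tendsto (fun ε : ℝ => τ + r * ε) (𝓝[>] 0) (𝓝 τ) := by
        have : Continuous fun ε : ℝ => τ + r * ε := by fun_prop
        have := this.tendsto 0
        rw [mul_zero, add_zero] at this
        exact this.mono_left nhdsWithin_le_nhds
      have := hprim.tendsto.comp h1
      rwa [intervalIntegral.integral_same] at this
    have h1 : Tendsto (fun ε : ℝ => (∫ x in α..β, u 0 x) + (∫ z in τ..(τ + (-1) * ε), u 0 z)
        - ∫ z in τ..(τ + 1 * ε), u 0 z) (𝓝[>] 0) (𝓝 ((∫ x in α..β, u 0 x) + 0 - 0)) :=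
      (tendsto_const_nhds.add (hlim (-1))).sub (hlim 1)
    rw [add_zero, sub_zero] at h1
    have h2 := (HasFinitePart.of_tendsto h1).add (hasFinitePart_poleSumPrimitive c m τ hTpos)
    rw [add_zero] at h2
    refine h2.congr' ?_
    filter_upwards [Ioo_mem_nhdsGT (lt_min (sub_pos.2 hτ.1) (sub_pos.2 hτ.2))] with ε hε
    have hε1 := hε.2.trans_le (min_le_left _ _)
    have hε2 := hε.2.trans_le (min_le_right _ _)
    rw [(hFintl ε hε.1 hε1).2, (hFintr ε hε.1 hε2).2]
    -- By periodicity of the primitive the contributions of the two ends cancel. What is left is its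
    -- jump at `τ`, with finite part zero.
    have hP : poleSumPrimitive c m τ T β = poleSumPrimitive c m τ T α := by
      rw [← poleSumPrimitive_add_period c m τ hTpos α]
      congr 1
      rw [hT]; ring
    have e1 : τ + (-1) * ε = τ - ε := by ring
    have hτm := Ioo_subset_Icc_self hτ
    have hm : τ - ε ∈ Icc α β := ⟨by linarith, by linarith [hε.1, hτ.2]⟩
    have hp : τ + ε ∈ Icc α β := ⟨by linarith [hε.1, hτ.1], by linarith⟩
    rw [hP, e1, one_mul,
      ← intervalIntegral.integral_add_adjacent_intervals (hu0i α hαm τ hτm) (hu0i τ hτm β hβm),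
      ← intervalIntegral.integral_add_adjacent_intervals (hu0i α hαm τ hτm) (hu0i τ hτm _ hm),
      ← intervalIntegral.integral_add_adjacent_intervals (hu0i τ hτm _ hp) (hu0i _ hp β hβm)]
    ring
  · obtain ⟨C, hC⟩ := exists_trapezoidal_error_le_of_interior hτ hq hcont hder
      (fun k hk => by rw [huα k hk, huβ k hk]) hint
    refine ⟨C, fun n hn => ?_⟩
    have hn0 : (0 : ℝ) < n := by exact_mod_cast hn
    -- At `x = β` the periodic extension takes the value `F α = 0`, which fits because `u 0 β = -W
    -- β`.
    have key : ∀ x ∈ Ioo τ (τ + T), (if x ≤ β then u 0 x else u 0 (x - T))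
        = periodicExtension F α β x - W x := by
      intro x hx
      rcases lt_trichotomy x β with hlt | rfl | hgt
      · have hx' : x ∈ Ioo α β := ⟨hτ.1.trans hx.1, hlt⟩
        rw [if_pos hlt.le, periodicExtension_eq (Ioo_subset_Ico_self hx'), huU 0 x hx',
          iteratedDeriv_zero, hFU x hx' hx.1.ne']
        ring
      · have h1 := periodicExtension_add_int_mul (F := F) hαβ α 1
        rw [Int.cast_one, one_mul, add_sub_cancel, periodicExtension_eq ⟨le_rfl, hαβ⟩, hFα] at h1
        have h2 := hWper 0
        rw [iteratedDeriv_zero] at h2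
        rw [if_pos le_rfl, h1, huβ 0 hq, iteratedDeriv_zero, h2, zero_sub]
      · have h1 := periodicExtension_add_int_mul (F := F) hαβ (x - T) 1
        have hx' : x - T ∈ Ioo α β := ⟨by linarith, by linarith [hx.2, hτ.2]⟩
        have h2 := poleSum_add_period c m τ hTpos (x - T)
        rw [sub_add_cancel] at h2
        rw [Int.cast_one, one_mul, ← hT, sub_add_cancel,
          periodicExtension_eq (Ioo_subset_Ico_self hx'),
          hFU _ hx' (by linarith [hx.2] : x - T < τ).ne] at h1
        rw [if_neg (not_le.2 hgt), h1, huU 0 _ hx', iteratedDeriv_zero, hW, h2]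
        ring
    -- The node `j = 0` is the pole: the sum of `F` omits it, while the sum of `W` includes the
    -- conventional value `W τ`. Adding `U τ + W τ` leaves the true value `U τ`.
    have hsum : ∑ j ∈ Finset.range n, (fun x => if x ≤ β then u 0 x else u 0 (x - T))
          (τ + j * (T / n))
        = ∑ j ∈ Finset.Icc 1 (n - 1), periodicExtension F α β (τ + j * (T / n))
          + (U τ + W τ) - ∑ j ∈ Finset.range n, W (τ + j * (T / n)) := by
      have hIcc : Finset.Icc 1 (n - 1) = Finset.Ico 1 n := by
        ext j
        simp only [Finset.mem_Icc, Finset.mem_Ico]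
        omega
      rw [hIcc, Finset.range_eq_Ico, Finset.sum_eq_sum_Ico_succ_bot (by omega),
        Finset.sum_eq_sum_Ico_succ_bot (by omega : 0 < n) (fun j : ℕ => W (τ + j * (T / n)))]
      have h0 : ∑ j ∈ Finset.Ico (0 + 1) n, (fun x => if x ≤ β then u 0 x else u 0 (x - T))
            (τ + j * (T / n))
          = ∑ j ∈ Finset.Ico 1 n, periodicExtension F α β (τ + j * (T / n))
            - ∑ j ∈ Finset.Ico (0 + 1) n, W (τ + j * (T / n)) := by
        rw [zero_add, ← Finset.sum_sub_distrib]
        refine Finset.sum_congr rfl fun j hj => key _ ?_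
        rw [Finset.mem_Ico] at hj
        have hj1 : (1 : ℝ) ≤ j := by exact_mod_cast hj.1
        have hj2 : (j : ℝ) < n := by exact_mod_cast hj.2
        have hTn : 0 < T / n := div_pos hTpos hn0
        refine ⟨by nlinarith, ?_⟩
        have : (j : ℝ) * (T / n) < n * (T / n) := mul_lt_mul_of_pos_right hj2 hTn
        rw [mul_div_cancel₀ _ hn0.ne'] at this
        linarith
      rw [h0]
      simp only [Nat.cast_zero, zero_mul, add_zero]
      rw [if_pos hτ.2.le, huU 0 τ hτ, iteratedDeriv_zero]
      ring
    have := hC n hn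
    rw [hsum] at this
    exact this

/-! ### Splitting the transformed integrand; extrapolation -/

theorem contDiffOn_regularFactor {g ψ : ℝ → ℝ} {α β a b τ : ℝ} (m : ℕ)
    (hψ : IsVariableTransformation ψ α β a b) (hg : ContDiffOn ℝ ∞ g (Ioo a b))
    (hτ : τ ∈ Ioo α β) : ContDiffOn ℝ ∞ (regularFactor g ψ τ m) (Ioo α β) := by
  refine ContDiffOn.mul (ContDiffOn.div ?_ ((contDiffOn_dslope hψ.contDiffOn hτ).pow m) ?_) ?_
  · exact hg.comp hψ.contDiffOn fun x hx => hψ.mem_Ioo hx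
  · intro x hx
    refine pow_ne_zero _ ?_
    rcases eq_or_ne x τ with rfl | hne
    · rw [dslope_same]; exact (hψ.deriv_pos x hx).ne'
    · intro h0
      have := sub_smul_dslope ψ τ x
      rw [h0, smul_zero] at this
      exact hψ.ne (Ioo_subset_Icc_self hx) (Ioo_subset_Icc_self hτ) hne this.symm
  · exact hψ.contDiffOn.deriv_of_isOpen isOpen_Ioo (m := ∞) (by simp)

theorem transformed_eq_regularFactor_div {g ψ : ℝ → ℝ} {α β τ ξ : ℝ} (m : ℕ) (hξ : ξ ∈ Ioo α β)
    (hne : ξ ≠ τ) : transformed (integrand g (ψ τ) m) ψ α β ξ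
      = regularFactor g ψ τ m ξ / (ξ - τ) ^ m := by
  have h := sub_smul_dslope ψ τ ξ
  rw [smul_eq_mul] at h
  rw [transformed, indicator_of_mem hξ, regularFactor, integrand, ← h, mul_pow]
  have : ξ - τ ≠ 0 := sub_ne_zero.2 hne
  rw [div_mul_eq_mul_div, div_mul_eq_mul_div, div_div, mul_comm ((ξ - τ) ^ m)]

/-- Taylor expansion of the regular factor to order `m` gives the principal part of `F` at `τ` and a
smooth remainder `V`. `U` is `V` minus the regular part of the periodic poles. -/
theorem exists_regularPart {g ψ : ℝ → ℝ} {α β a b τ : ℝ} (m : ℕ)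
    (hψ : IsVariableTransformation ψ α β a b) (hg : ContDiffOn ℝ ∞ g (Ioo a b))
    (hτ : τ ∈ Ioo α β) {c : ℕ → ℝ}
    (hc : c = fun k => iteratedDeriv k (regularFactor g ψ τ m) τ / (k.factorial : ℝ)) :
    ∃ U, ContDiffOn ℝ ∞ U (Ioo α β) ∧
      (∀ ξ ∈ Ioo α β, ξ ≠ τ → transformed (integrand g (ψ τ) m) ψ α β ξ
        = U ξ + poleSum c m τ (β - α) ξ) ∧ U τ + poleSum c m τ (β - α) τ = c m := by
  have hT : 0 < β - α := sub_pos.2 (hτ.1.trans hτ.2)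
  have hsub : Ioo α β ⊆ Ioo (τ - (β - α)) (τ + (β - α)) := fun x hx =>
    ⟨by linarith [hx.1, hτ.2], by linarith [hx.2, hτ.1]⟩
  obtain ⟨V, hV, hVτ, hGV⟩ := exists_taylor_factor m (contDiffOn_regularFactor m hψ hg hτ) hτ
  refine ⟨fun ξ => V ξ - poleSumTail c m τ (β - α) ξ,
    hV.sub ((contDiffOn_poleSumTail c m τ hT).mono hsub), fun ξ hξ hne => ?_, ?_⟩
  · have hne' : ξ - τ ≠ 0 := sub_ne_zero.2 hne
    rw [transformed_eq_regularFactor_div m hξ hne, hGV ξ, add_div,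
      mul_div_cancel_left₀ _ (pow_ne_zero _ hne'), Finset.sum_div, poleSum_eq c m τ hT (hsub hξ)]
    have : ∀ k ∈ Finset.range m, iteratedDeriv k (regularFactor g ψ τ m) τ / (k.factorial : ℝ)
        * (ξ - τ) ^ k / (ξ - τ) ^ m = c k * ((ξ - τ) ^ (m - k))⁻¹ := by
      intro k hk
      rw [pow_sub₀ _ hne' (Finset.mem_range.1 hk).le, mul_inv, inv_inv, hc]
      ring
    rw [Finset.sum_congr rfl this]
    ring
  -- At `τ` the principal part is `0` by the convention `0⁻¹ = 0`, so the regular parts cancel and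
  -- `V τ = c m` remains.
  · rw [poleSum_eq c m τ hT (hsub hτ), Finset.sum_eq_zero]
    · simp only [hVτ, hc]
      ring
    · intro k hk
      have := Finset.mem_range.1 hk
      rw [sub_self, zero_pow (by omega), inv_zero, mul_zero]

/-- The extrapolation weights sum to one, so each error is a fixed combination of the previous
errors at `n` and `2n`. No cancellation of powers is needed. -/
theorem isBigO_quadrature {Φ G : ℝ → ℝ} {τ T I : ℝ} {m q : ℕ}
    (h : (fun n : ℕ => correctedTrapezoidal Φ G τ T m n - I)
      =O[atTop] fun n : ℕ => (n : ℝ) ^ (-(q : ℤ))) (s : ℕ) :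
    (fun n : ℕ => quadrature Φ G τ T m s n - I) =O[atTop] fun n : ℕ => (n : ℝ) ^ (-(q : ℤ)) := by
  induction s with
  | zero => exact h
  | succ s ih =>
    -- The exponent is odd, hence nonzero.
    have hA : (2 : ℝ) ^ (1 - 2 * (s : ℤ)) - 1 ≠ 0 := by
      rw [sub_ne_zero]
      intro h1
      have := zpow_right_injective₀ (a := (2 : ℝ)) (by norm_num) (by norm_num)
        (h1.trans (zpow_zero (2 : ℝ)).symm)
      omega
    have h2n : Tendsto (fun n : ℕ => 2 * n) atTop atTop :=
      tendsto_id.const_mul_atTop' (by norm_num)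
    have h2 : (fun n : ℕ => quadrature Φ G τ T m s (2 * n) - I)
        =O[atTop] fun n : ℕ => (n : ℝ) ^ (-(q : ℤ)) := by
      refine (ih.comp_tendsto h2n).trans ?_
      refine IsBigO.of_bound ((2 : ℝ) ^ (-(q : ℤ))) (Eventually.of_forall fun n => ?_)
      simp only [Function.comp]
      push_cast
      rw [mul_zpow, norm_mul, Real.norm_of_nonneg (zpow_nonneg (by norm_num : (0 : ℝ) ≤ 2) _)]
    have h3 := ((h2.const_mul_left ((2 : ℝ) ^ (1 - 2 * (s : ℤ)))).sub ih).const_mul_left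
      ((2 : ℝ) ^ (1 - 2 * (s : ℤ)) - 1)⁻¹
    refine h3.congr_left fun n => ?_
    rw [quadrature]
    field_simp
    ring

end PVTSI

theorem theorem5p2
    (a b t α β τ : ℝ) (g ψ : ℝ → ℝ) (m q : ℕ)
    (hαβ : α < β) (ht : t ∈ Ioo a b) (hm : 1 ≤ m) (hq : 1 ≤ q)
    (hg : ContDiffOn ℝ ∞ g (Ioo a b)) (hgint : IntegrableOn g (Ioo a b))
    (hψ : PVTSI.IsVariableTransformation ψ α β a b)
    (hτ : τ ∈ Ioo α β) (hψτ : ψ τ = t)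
    (hper : PVTSI.IsPeriodizedToOrder (PVTSI.periodized g t m ψ α β) α β τ q) :
    -- the quadrature formulas converge to the common value `I[f] = I[F]`, with error `O(n^{-q})`
    (∃ I : ℝ,
      PVTSI.HasHadamardFinitePart (PVTSI.integrand g t m) a b t I ∧
      PVTSI.HasHadamardFinitePart
        (PVTSI.transformed (PVTSI.integrand g t m) ψ α β) α β τ I ∧
      ∀ s ≤ (m + 2) / 2,
        Tendsto (fun n : ℕ => PVTSI.quadrature (PVTSI.periodized g t m ψ α β)
          (PVTSI.regularFactor g ψ τ m) τ (β - α) m s n) atTop (𝓝 I) ∧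
        (fun n : ℕ => PVTSI.quadrature (PVTSI.periodized g t m ψ α β)
          (PVTSI.regularFactor g ψ τ m) τ (β - α) m s n - I)
            =O[atTop] fun n : ℕ => (n : ℝ) ^ (-(q : ℤ))) ∧
    -- of `g`, only the behaviour at the endpoints matters for `q`
    (∀ g₁ : ℝ → ℝ, ContDiffOn ℝ ∞ g₁ (Ioo a b) → g₁ =ᶠ[𝓝[>] a] g → g₁ =ᶠ[𝓝[<] b] g →
      PVTSI.IsPeriodizedToOrder (PVTSI.periodized g₁ t m ψ α β) α β τ q) ∧
    -- `q` is independent of `m` (and of the location of the singularity)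
    (ContDiffOn ℝ q ψ (Icc α β) →
      ∀ m₁ : ℕ, 1 ≤ m₁ → ∀ τ₁ ∈ Ioo α β,
        PVTSI.IsPeriodizedToOrder (PVTSI.periodized g (ψ τ₁) m₁ ψ α β) α β τ₁ q) := by
  open PVTSI in
  subst hψτ
  refine ⟨?_, fun g₁ hg₁ ha hb => hper.of_eventuallyEq hψ hg hg₁ hτ ha hb,
    fun hψq m₁ _ τ₁ hτ₁ => hper.change_pole hψ hg hτ hτ₁ hψq⟩
  obtain ⟨hl, hr⟩ := (isPeriodizedToOrder_periodized_iff hψ hg hτ).1 hper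
  obtain ⟨U, hU, hFU, hUτ⟩ := exists_regularPart m hψ hg hτ rfl
  obtain ⟨I, hI, C, hC⟩ := exists_hadamardFinitePart_trapezoidal hτ hq hU hFU
    (by rw [transformed, indicator_of_notMem fun h => lt_irrefl _ h.1]) hl hr
  -- The integrability of `F` up to the endpoints is read off from the finite part just obtained.
  -- Uniqueness then identifies the limit of the rule with the finite part that is shared with `f`.
  obtain ⟨J, hJf, hJF⟩ := exists_hadamardFinitePart (m := m) hg hgint hψ hτ rfl
    (fun x hx => by
      have := hI.integrable_left (τ - x) (sub_pos.2 hx.2) (by linarith [hx.1])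
      rwa [sub_sub_cancel] at this)
    (fun x hx => by
      have := hI.integrable_right (x - τ) (sub_pos.2 hx.1) (by linarith [hx.2])
      rwa [add_sub_cancel] at this)
  obtain rfl : I = J := hI.unique hJF
  have hT : 0 < β - α := sub_pos.2 hαβ
  have hO : (fun n : ℕ => correctedTrapezoidal (periodized g (ψ τ) m ψ α β)
      (regularFactor g ψ τ m) τ (β - α) m n - I) =O[atTop] fun n : ℕ => (n : ℝ) ^ (-(q : ℤ)) := by
    refine IsBigO.of_bound (C * (β - α) ^ q) ?_
    filter_upwards [eventually_ge_atTop 1] with n hn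
    have h := hC n hn
    rw [hUτ] at h
    rw [correctedTrapezoidal_eq _ _ τ hT m hn, Real.norm_eq_abs]
    refine h.trans (le_of_eq ?_)
    rw [Real.norm_of_nonneg (zpow_nonneg n.cast_nonneg _), div_pow, zpow_neg, zpow_natCast]
    ring
  have hlim : Tendsto (fun n : ℕ => (n : ℝ) ^ (-(q : ℤ))) atTop (𝓝 0) := by
    have h1 := (tendsto_pow_atTop (α := ℝ) (by omega : q ≠ 0)).inv_tendsto_atTop.comp
      tendsto_natCast_atTop_atTop
    refine h1.congr fun n => ?_
    simp only [Function.comp, Pi.inv_apply]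
    rw [zpow_neg, zpow_natCast]
  refine ⟨I, hJf, hI, fun s _ => ?_⟩
  have h := isBigO_quadrature hO s
  refine ⟨?_, h⟩
  have := (h.trans_tendsto hlim).add_const I
  simpa using this
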